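/- Let $n\ge 2$ and let $\beta=(\beta_{ij})_{i,j\ge 0,\ i+j\le 2n}$ be real numbers with $\beta_{00}>0$. For $k\ge 0$ and a real family $\gamma=(\gamma_{ij})_{i+j\le 2k}$, let $M(k)(\gamma)$ be the matrix whose rows and columns are indexed by the monomials $Y^iX^j$ with $i+j\le k$ and whose entry in row $Y^iX^j$, column $Y^rX^s$ is $\gamma_{i+r,\,j+s}$. For a real polynomial $p(x,y)=\sum a_{ij}y^ix^j$ of degree at most $k$ let $p(X,Y)=\sum a_{ij}Y^iX^j$ be the corresponding combination of the columns of $M(k)(\gamma)$. Call $M(k)(\gamma)$ *positive* if it is positive semidefinite, and *recursively generated* if, whenever $p$, $q$, $pq$ are polynomials of degree at most $k$ with $p(X,Y)=0$, also $(pq)(X,Y)=0$. A *moment matrix extension* $M(k+1)$ of $M(k)(\gamma)$ is a matrix $M(k+1)(\gamma')$ where $\gamma'=(\gamma'_{ij})_{i+j\le 2k+2}$ is real with $\gamma'_{ij}=\gamma_{ij}$ for $i+j\le 2k$; it is *flat* if $\operatorname{rank}M(k+1)=\operatorname{rank}M(k)$. A *representing measure* for $\beta$ is a positive Borel measure $\mu$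 on $\mathbb R^2$ with convergent moments up to degree $2n$ and $\beta_{ij}=\int y^ix^j\,d\mu$ for all $i+j\le 2n$. Write $M(n)=M(n)(\beta)$ and let $V(M(n))\subseteq\mathbb R^2$ be the set of common real zeros of all polynomials $p$ of degree at most $n$ with $p(X,Y)=0$ in the column space of $M(n)$. Let $Q(x,y)=ax^2+bxy+cy^2+dx+ey+f$ be a real polynomial with $b^2-4ac>0$, so that $H=\{(x,y)\in\mathbb R^2: Q(x,y)=0\}$ is a hyperbola, possibly degenerate (two intersecting lines). Assume that $M(n)$ is positive, recursively generated, and satisfies $Q(X,Y)=0$. Then $\operatorname{rank}M(n)\le 2n+1$, every representing measure for $\beta$ is supported in $H$, and the following statements are equivalent. (i) $\beta$ has a representing measure. (ii) $\beta$ has a representing measure with convergent moments of degree up to $2n+2$. (iii) $\beta$ has a representing measure $\mu$ with $\operatorname{card}\operatorname{supp}\mu\le 1+\operatorname{rank}M(n)$; moreover, if $\operatorname{rank}M(n)\le 2n$, then $\beta$ has a representing measure $\mu$ with $\operatorname{card}\operatorname{supp}\mu=\operatorname{rank}M(n)$. (iv) $M(n)$ has a positive, recursively generated moment matrix extension $M(n+1)$.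 (v) $M(n)$ has a positive, recursively generated moment matrix extension $M(n+1)$ with $\operatorname{rank}M(n+1)\le 1+\operatorname{rank}M(n)$ that itself has a flat extension $M(n+2)$; moreover, if $\operatorname{rank}M(n)\le 2n$, then $M(n)$ has a flat extension $M(n+1)$. (vi) $\operatorname{rank}M(n)\le\operatorname{card}V(M(n))$. -/

import Mathlib

namespace TruncMoment

open MeasureTheory

/-- The exponents `(i, j)` of the monomials `y ^ i * x ^ j` of degree at most `n`. They index the
rows and columns of the moment matrix `M(n)`. -/
def monomials (n : ℕ) : Finset (ℕ × ℕ) :=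
  (Finset.range (n + 1) ×ˢ Finset.range (n + 1)).filter fun a => a.1 + a.2 ≤ n

theorem mem_monomials {n : ℕ} {a : ℕ × ℕ} : a ∈ monomials n ↔ a.1 + a.2 ≤ n := by
  simp only [monomials, Finset.mem_filter, Finset.mem_product, Finset.mem_range]
  omega

/-- The moment matrix `M(n)(β)`: the entry in row `Y ^ i X ^ j` and column `Y ^ k X ^ l` is
`β (i + k) (j + l)`. Only the values `β i j` with `i + j ≤ 2 * n` occur, so `β` stands for the
truncated family of degree `2 * n`. -/
def momentMatrix (n : ℕ) (β : ℕ → ℕ → ℝ) : Matrix (monomials n) (monomials n) ℝ :=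
  Matrix.of fun a b => β (a.1.1 + b.1.1) (a.1.2 + b.1.2)

/-- The vector of coefficients of `p` on the monomials of degree at most `n`. The variable `X 0` is
`x` and the variable `X 1` is `y`. -/
noncomputable def coeffVec (n : ℕ) (p : MvPolynomial (Fin 2) ℝ) : monomials n → ℝ :=
  fun a => p.coeff (Finsupp.single 0 a.1.2 + Finsupp.single 1 a.1.1)

/-- For `p = ∑ a i j * y ^ i * x ^ j` of degree at most `n`, the element
`p(X, Y) = ∑ a i j • Y ^ i X ^ j` of the column space of `M(n)(β)`. -/
noncomputable def column (n : ℕ) (β : ℕ → ℕ → ℝ) (p : MvPolynomial (Fin 2) ℝ) :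
    monomials n → ℝ :=
  (momentMatrix n β).mulVec (coeffVec n p)

/-- `M(n)(β)` is recursively generated. -/
def RecursivelyGenerated (n : ℕ) (β : ℕ → ℕ → ℝ) : Prop :=
  ∀ p q : MvPolynomial (Fin 2) ℝ, p.totalDegree ≤ n → q.totalDegree ≤ n →
    (p * q).totalDegree ≤ n → column n β p = 0 → column n β (p * q) = 0

/-- The real zero set of `p` in the plane, a point being `z = (x, y)`. -/
def zeroSet (p : MvPolynomial (Fin 2) ℝ) : Set (ℝ × ℝ) :=
  {z | MvPolynomial.eval ![z.1, z.2] p = 0}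

/-- The variety of `M(n)(β)`: the common zeros of all the polynomials of degree at most `n` that
give a column relation. -/
def variety (n : ℕ) (β : ℕ → ℕ → ℝ) : Set (ℝ × ℝ) :=
  {z | ∀ p : MvPolynomial (Fin 2) ℝ, p.totalDegree ≤ n → column n β p = 0 → z ∈ zeroSet p}

/-- The equation `Q = 0` is that of a hyperbola: `Q` is a quadratic polynomial whose quadratic part
has positive discriminant. A hyperbola may be degenerate (two intersecting lines). -/
def IsHyperbola (Q : MvPolynomial (Fin 2) ℝ) : Prop :=
  ∃ a b c d e f : ℝ, 0 < b ^ 2 - 4 * a * c ∧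
    Q = MvPolynomial.C a * MvPolynomial.X 0 ^ 2
      + MvPolynomial.C b * (MvPolynomial.X 0 * MvPolynomial.X 1)
      + MvPolynomial.C c * MvPolynomial.X 1 ^ 2
      + MvPolynomial.C d * MvPolynomial.X 0 + MvPolynomial.C e * MvPolynomial.X 1
      + MvPolynomial.C f

/-- All moments of `μ` of degree at most `m` converge. -/
def HasMoments (m : ℕ) (μ : Measure (ℝ × ℝ)) : Prop :=
  ∀ i j : ℕ, i + j ≤ m → Integrable (fun z : ℝ × ℝ => z.2 ^ i * z.1 ^ j) μ

/-- `μ` is a representing measure for the truncated family `β i j`, `i + j ≤ 2 * n`. -/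
def IsRepresenting (n : ℕ) (β : ℕ → ℕ → ℝ) (μ : Measure (ℝ × ℝ)) : Prop :=
  HasMoments (2 * n) μ ∧ ∀ i j : ℕ, i + j ≤ 2 * n → β i j = ∫ z : ℝ × ℝ, z.2 ^ i * z.1 ^ j ∂μ

/-- `M(n + 1)(β')` is an extension of `M(n)(β)`. -/
def Extends (n : ℕ) (β β' : ℕ → ℕ → ℝ) : Prop :=
  ∀ i j : ℕ, i + j ≤ 2 * n → β' i j = β i j

/-- `M(n + 1)(β')` is a flat extension of `M(n)(β)`. -/
def FlatExtends (n : ℕ) (β β' : ℕ → ℕ → ℝ) : Prop :=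
  Extends n β β' ∧ (momentMatrix (n + 1) β').rank = (momentMatrix n β).rank

/-- `M(n + 1)(β')` is a positive, recursively generated extension of `M(n)(β)`. -/
def PosRecExtends (n : ℕ) (β β' : ℕ → ℕ → ℝ) : Prop :=
  Extends n β β' ∧ (momentMatrix (n + 1) β').PosSemidef ∧ RecursivelyGenerated (n + 1) β'

end TruncMoment

open TruncMoment

/-! In suitable affine coordinates `Q = u * v - C κ`. Recursive generation makes the Riesz
functional vanish on the multiples of `Q` of degree at most `2 * n`, so it comes from a functional
`l` on the coordinate ring of the curve (`exists_riesz_mod`). The decisive property is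
`StronglyRecursive`: null functions of `l (p * p)` stay null under multiplication by `u` or `v`
whenever the product has degree at most `n` on the curve, that is, modulo `Q`. Plain recursive
generation only sees products whose degree as polynomials is at most `n`.

Strong recursiveness follows from a positive, recursively generated extension, where products of
degree `n + 1` are still visible (`stronglyRecursive_of_extension`). It also follows from the
variety condition: if `rank M(n)` points of the variety are separated in degree `n`, a dimension
count shows that the column relations are exactly the polynomials vanishing there
(`stronglyRecursive_of_separates`). When the two lines of a degenerate hyperbola meet in the
variety, an argument on each line replaces the count.

Conversely, strong recursiveness yields finitely many atoms (`HasAtoms`). For `κ ≠ 0` the curve is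
parametrized by `u ≠ 0`, and functions of degree `n` on it are `u ^ (-n) * f(u)` with `f` of degree
at most `2 * n`. What remains is a truncated Hamburger problem with nodes avoiding `0`, solved by
Gauss quadrature (`exists_quadrature`); multiplication by `v` corresponds to division by `u`. For `κ
= 0` each line carries its own one-variable problem, and the two share the mass at the crossing. On
each line the largest mass that can be split off at the origin is found; positivity on the union
says that these two masses together are at least the total mass, counted twice when the lines are
added separately (`exists_axis_quadrature`, `exists_cross_quadrature`). The exceptional case has `n
+ 1` atoms on each line, hence `2 * n + 2` atoms at rank `2 * n + 1`; this is the source of the term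
`1 + rank`.

Atoms give measures with all moments, and their own moments give the extensions. Finally, a measure
lives on the variety, so polynomials vanishing there are column relations, which bounds the rank by
the number of its points. -/

namespace TruncMoment

open Polynomial

/-! ### Positive forms, null vectors, and real-rooted polynomials -/

section PositiveFunctional

variable {A : Type*} [CommRing A] [Algebra ℝ A]

/-- Cauchy--Schwarz, degenerate case: a null vector of a positive form is orthogonal to
everything. -/
theorem map_mul_eq_zero_of_null (l : A →ₗ[ℝ] ℝ) (M : Submodule ℝ A)
    (hpos : ∀ f ∈ M, 0 ≤ l (f * f)) {f g : A} (hf : f ∈ M) (hg : g ∈ M) (h0 : l (f * f) = 0) :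
    l (f * g) = 0 := by
  by_contra hc
  have key : ∀ t : ℝ, 0 ≤ 2 * t * l (f * g) + l (g * g) := by
    intro t
    have h := hpos (t • f + g) (M.add_mem (M.smul_mem t hf) hg)
    have e : (t • f + g) * (t • f + g) = (t * t) • (f * f) + (2 * t) • (f * g) + g * g := by
      simp only [Algebra.smul_def, map_mul, map_ofNat]
      ring
    rw [e, map_add, map_add, map_smul, map_smul, h0, smul_eq_mul, smul_eq_mul] at h
    linarith
  -- This `t` makes the expression in `key` equal to `-1`.
  have h := key (-(l (g * g) + 1) / (2 * l (f * g)))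
  have e : 2 * (-(l (g * g) + 1) / (2 * l (f * g))) * l (f * g) = -(l (g * g) + 1) := by
    field_simp
  rw [e] at h
  linarith

/-- The cross term vanishes by Cauchy–Schwarz, so the null vectors form a subspace. -/
theorem null_smul_add (l : A →ₗ[ℝ] ℝ) (M : Submodule ℝ A)
    (hpos : ∀ f ∈ M, 0 ≤ l (f * f)) {f g : A} (t : ℝ) (hf : f ∈ M) (hg : g ∈ M)
    (hf0 : l (f * f) = 0) (hg0 : l (g * g) = 0) : l ((t • f + g) * (t • f + g)) = 0 := by
  have e : (t • f + g) * (t • f + g) = (t * t) • (f * f) + (2 * t) • (f * g) + g * g := by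
    simp only [Algebra.smul_def, map_mul, map_ofNat]
    ring
  rw [e, map_add, map_add, map_smul, map_smul, hf0, hg0,
    map_mul_eq_zero_of_null l M hpos hf hg hf0]
  simp

end PositiveFunctional

/-- A symmetric bilinear form represents every functional that vanishes on its kernel. -/
theorem exists_represents {W : Type*} [AddCommGroup W] [Module ℝ W] [FiniteDimensional ℝ W]
    (B : W →ₗ[ℝ] W →ₗ[ℝ] ℝ) (hB : ∀ x y, B x y = B y x) (φ : W →ₗ[ℝ] ℝ)
    (h : ∀ w, (∀ x, B w x = 0) → φ w = 0) : ∃ w, ∀ x, B w x = φ x := by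
  have h1 : φ ∈ (LinearMap.ker B).dualAnnihilator := by
    rw [Submodule.mem_dualAnnihilator]
    intro w hw
    refine h w fun x => ?_
    rw [LinearMap.mem_ker] at hw
    simp [hw]
  rw [← LinearMap.range_dualMap_eq_dualAnnihilator_ker] at h1
  obtain ⟨ψ, hψ⟩ := h1
  obtain ⟨w, rfl⟩ := (Module.evalEquiv ℝ W).surjective ψ
  refine ⟨w, fun x => ?_⟩
  rw [← hψ, hB]
  simp

theorem mem_degreeLT_succ {d : ℕ} {f : ℝ[X]} : f ∈ degreeLT ℝ (d + 1) ↔ f.natDegree ≤ d := by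
  rcases eq_or_ne f 0 with rfl | hf
  · simp
  · rw [mem_degreeLT, degree_eq_natDegree hf, Nat.cast_lt, Nat.lt_succ_iff]

theorem natDegree_X_mul_le {f : ℝ[X]} {d : ℕ} (h : f.natDegree ≤ d) :
    (X * f).natDegree ≤ d + 1 :=
  natDegree_mul_le.trans (by rw [natDegree_X]; omega)

/-- A real polynomial with no factor `(X - a) ^ 2 + b ^ 2` has only real and simple roots. -/
theorem card_roots_toFinset_of_no_quadratic {g : ℝ[X]} (hg : g ≠ 0)
    (h : ∀ (a b : ℝ) (q : ℝ[X]), g ≠ ((X - C a) ^ 2 + C (b ^ 2)) * q) :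
    g.roots.toFinset.card = g.natDegree ∧ g.roots.card = g.natDegree ∧ g.roots.Nodup := by
  have hnd : g.roots.Nodup := by
    rw [Multiset.nodup_iff_count_le_one]
    intro a
    by_contra hc
    rw [count_roots] at hc
    obtain ⟨q, hq⟩ := (le_rootMultiplicity_iff hg (a := a) (n := 2)).1 (by omega)
    -- The excluded quadratic factor with `b = 0` is a double root.
    exact h a 0 q (by rw [hq]; simp)
  have hs : g.Splits := by
    by_contra hns
    have hc : (g.map (algebraMap ℝ ℂ)).Splits := IsAlgClosed.splits _
    apply hns
    refine hc.of_splits_map_of_injective (algebraMap ℝ ℂ).injective ?_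
    intro z hz
    by_contra hz'
    have hz0 : aeval z g = 0 := by
      have := (mem_roots'.1 hz).2
      rwa [IsRoot, eval_map_algebraMap] at this
    have him : z.im ≠ 0 := by
      intro h0
      exact hz' ⟨z.re, by apply Complex.ext <;> simp [h0]⟩
    obtain ⟨q, hq⟩ := g.quadratic_dvd_of_aeval_eq_zero_im_ne_zero hz0 him
    refine h z.re z.im q ?_
    nth_rewrite 1 [hq]
    congr 1
    have : ‖z‖ ^ 2 = z.re ^ 2 + z.im ^ 2 := by
      rw [← Complex.normSq_eq_norm_sq, Complex.normSq_apply]; ring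
    rw [this]
    simp only [map_add, map_mul, map_pow, map_ofNat]
    ring
  have hcard := splits_iff_card_roots.1 hs
  exact ⟨by rw [Multiset.toFinset_card_of_nodup hnd, hcard], hcard, hnd⟩

end TruncMoment

/-! ### Gauss quadrature on the punctured line -/

namespace TruncMoment

open Polynomial

theorem prod_roots_dvd_of_eval_eq_zero {g f : ℝ[X]} (hg : g ≠ 0) (hcard : g.roots.card = g.natDegree)
    (hnd : g.roots.Nodup) (hf : ∀ s ∈ g.roots, f.eval s = 0) : g ∣ f := by
  rcases eq_or_ne f 0 with rfl | hf0
  · exact dvd_zero _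
  have h1 : (g.roots.map fun a => X - C a).prod ∣ f := by
    rw [Multiset.prod_X_sub_C_dvd_iff_le_roots hf0, Multiset.le_iff_subset hnd]
    intro s hs
    exact (mem_roots hf0).2 (hf s hs)
  rw [← C_leadingCoeff_mul_prod_multiset_X_sub_C hcard]
  exact (IsUnit.mul_left_dvd (isUnit_C.2 (leadingCoeff_ne_zero.2 hg).isUnit)).2 h1

/-- The quadrature rule whose nodes are the roots of a generating polynomial `g`. -/
theorem exists_quadrature_of_generator (l : ℝ[X] →ₗ[ℝ] ℝ) {d : ℕ} {g : ℝ[X]} (hg : g ≠ 0)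
    (hdeg : g.natDegree ≤ d + 1) (hz : g.eval 0 ≠ 0)
    (horth : ∀ q : ℝ[X], (g * q).natDegree ≤ 2 * d → l (g * q) = 0)
    (hpos : ∀ f : ℝ[X], f ≠ 0 → f.natDegree < g.natDegree → 0 < l (f * f)) :
    ∃ (S : Finset ℝ) (w : ℝ → ℝ), (0 : ℝ) ∉ S ∧ S.card = g.natDegree ∧ (∀ s ∈ S, 0 < w s) ∧
      ∀ f : ℝ[X], f.natDegree ≤ 2 * d → l f = ∑ s ∈ S, w s * f.eval s := by
  -- If `g` had this factor, `l (g * q)` would be a positive square plus a nonnegative one, against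
  -- orthogonality; here `deg (g * q) = 2 * deg g - 2 ≤ 2 * d`.
  have hno : ∀ (a b : ℝ) (q : ℝ[X]), g ≠ ((X - C a) ^ 2 + C (b ^ 2)) * q := by
    intro a b q e
    have hq : q ≠ 0 := by rintro rfl; simp at e; exact hg e
    have hquad : ((X - C a) ^ 2 + C (b ^ 2)).natDegree = 2 := by
      compute_degree!
    have hquad0 : ((X - C a) ^ 2 + C (b ^ 2)) ≠ 0 := by
      intro h; rw [h] at hquad; simp at hquad
    have hgd : g.natDegree = 2 + q.natDegree := by
      rw [e, natDegree_mul hquad0 hq, hquad]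
    have hlq : l (g * q) = 0 := by
      apply horth
      rw [natDegree_mul hg hq]
      omega
    have e2 : g * q = ((X - C a) * q) * ((X - C a) * q) + (b ^ 2) • (q * q) := by
      rw [e, smul_eq_C_mul]; ring
    have hp1 : 0 < l (((X - C a) * q) * ((X - C a) * q)) := by
      apply hpos _ (mul_ne_zero (X_sub_C_ne_zero a) hq)
      rw [natDegree_mul (X_sub_C_ne_zero a) hq, natDegree_X_sub_C]
      omega
    have hp2 : 0 < l (q * q) := hpos _ hq (by omega)
    rw [e2, map_add, map_smul, smul_eq_mul] at hlq
    nlinarith [mul_nonneg (sq_nonneg b) hp2.le]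
  obtain ⟨hc1, hc2, hnd⟩ := card_roots_toFinset_of_no_quadratic hg hno
  set S := g.roots.toFinset with hS
  have hinj : Set.InjOn (id : ℝ → ℝ) (S : Set ℝ) := Function.injective_id.injOn
  have hbdeg : ∀ s ∈ S, (Lagrange.basis S id s).natDegree = S.card - 1 := fun s hs =>
    Lagrange.natDegree_basis hinj hs
  have hbself : ∀ s ∈ S, (Lagrange.basis S id s).eval s = 1 := fun s hs =>
    Lagrange.eval_basis_self hinj hs
  have hbne : ∀ s t, s ≠ t → t ∈ S → (Lagrange.basis S id s).eval t = 0 := fun s t hst ht =>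
    Lagrange.eval_basis_of_ne (v := id) hst ht
  refine ⟨S, fun s => l (Lagrange.basis S id s * Lagrange.basis S id s), ?_, hc1, ?_, ?_⟩
  · intro h0
    rw [hS, Multiset.mem_toFinset] at h0
    exact hz (mem_roots'.1 h0).2
  · intro s hs
    have hcpos : 0 < S.card := Finset.card_pos.2 ⟨s, hs⟩
    refine hpos _ (Lagrange.basis_ne_zero hinj hs) ?_
    rw [hbdeg s hs]
    omega
  · intro f hf
    -- Interpolating with squares of the Lagrange basis makes the weights values of `l` at squares,
    -- hence positive. The squares have degree at most `2 * d`, so orthogonality to `g` still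
    -- applies.
    have hdvd : g ∣ f - ∑ s ∈ S, f.eval s • (Lagrange.basis S id s * Lagrange.basis S id s) := by
      refine prod_roots_dvd_of_eval_eq_zero hg hc2 hnd fun t ht => ?_
      have ht' : t ∈ S := Multiset.mem_toFinset.2 ht
      rw [eval_sub, eval_finsetSum, Finset.sum_eq_single_of_mem t ht']
      · simp [hbself t ht']
      · intro s _ hst
        simp [hbne s t hst ht']
    obtain ⟨q, hq⟩ := hdvd
    have hl := horth q (by
      rw [← hq]
      refine (natDegree_sub_le _ _).trans (max_le hf ?_)
      refine natDegree_sum_le_of_forall_le _ _ fun s hs => ?_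
      refine (natDegree_smul_le _ _).trans (natDegree_mul_le.trans ?_)
      rw [hbdeg s hs]
      omega)
    rw [← hq, map_sub, map_sum, sub_eq_zero] at hl
    rw [hl]
    exact Finset.sum_congr rfl fun s _ => by rw [map_smul, smul_eq_mul, mul_comm]

/-- The bilinear form `(p, q) ↦ l (a p * a q)` on the polynomials of degree at most `d`. -/
noncomputable def weightedForm (l : ℝ[X] →ₗ[ℝ] ℝ) (a : ℝ[X]) (d : ℕ) :
    degreeLT ℝ (d + 1) →ₗ[ℝ] degreeLT ℝ (d + 1) →ₗ[ℝ] ℝ :=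
  LinearMap.mk₂ ℝ (fun p q => l ((a * p.1) * (a * q.1)))
    (fun p q r => by simp only [Submodule.coe_add]; rw [← map_add]; congr 1; ring)
    (fun c p q => by
      rw [← map_smul, smul_eq_C_mul, SetLike.val_smul, smul_eq_C_mul]
      congr 1; ring)
    (fun p q r => by simp only [Submodule.coe_add]; rw [← map_add]; congr 1; ring)
    (fun c p q => by
      rw [← map_smul, smul_eq_C_mul, SetLike.val_smul, smul_eq_C_mul]
      congr 1; ring)

/-- Applied with `a = 1` to build orthogonal polynomials and with `a = X` to minimize over
polynomials with prescribed value at `0`. -/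
theorem exists_represents_weighted (l : ℝ[X] →ₗ[ℝ] ℝ) (a : ℝ[X]) (d : ℕ)
    (φ : ℝ[X] →ₗ[ℝ] ℝ)
    (h : ∀ f : ℝ[X], f.natDegree ≤ d → l ((a * f) * (a * f)) = 0 → φ f = 0) :
    ∃ f : ℝ[X], f.natDegree ≤ d ∧ ∀ q : ℝ[X], q.natDegree ≤ d → l ((a * f) * (a * q)) = φ q := by
  obtain ⟨w, hw⟩ := exists_represents (weightedForm l a d)
    (fun x y => by simp [weightedForm, mul_comm]) (φ.comp (Submodule.subtype _))
    (fun w hw => h w.1 (mem_degreeLT_succ.1 w.2) (hw w))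
  exact ⟨w.1, mem_degreeLT_succ.1 w.2, fun q hq => hw ⟨q, mem_degreeLT_succ.2 hq⟩⟩

/-- The truncated Hamburger moment problem on the punctured line: a positive functional whose kernel
is stable under multiplication and division by `X` has a quadrature rule avoiding `0`. -/
theorem exists_quadrature (l : ℝ[X] →ₗ[ℝ] ℝ) (d : ℕ)
    (hpos : ∀ f : ℝ[X], f.natDegree ≤ d → 0 ≤ l (f * f))
    (hup : ∀ f : ℝ[X], f.natDegree < d → l (f * f) = 0 → l ((X * f) * (X * f)) = 0)
    (hdown : ∀ f : ℝ[X], f.natDegree < d → l ((X * f) * (X * f)) = 0 → l (f * f) = 0) :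
    ∃ (S : Finset ℝ) (w : ℝ → ℝ), (0 : ℝ) ∉ S ∧ S.card ≤ d + 1 ∧
      ((∃ f : ℝ[X], f ≠ 0 ∧ f.natDegree ≤ d ∧ l (f * f) = 0) → S.card ≤ d) ∧
      (∀ s ∈ S, 0 < w s) ∧
      ∀ f : ℝ[X], f.natDegree ≤ 2 * d → l f = ∑ s ∈ S, w s * f.eval s := by
  have horth : ∀ f g : ℝ[X], f.natDegree ≤ d → g.natDegree ≤ d → l (f * f) = 0 → l (f * g) = 0 :=
    fun f g hf hg h0 => map_mul_eq_zero_of_null l (degreeLT ℝ (d + 1))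
      (fun f hf => hpos f (mem_degreeLT_succ.1 hf)) (mem_degreeLT_succ.2 hf)
      (mem_degreeLT_succ.2 hg) h0
  by_cases hK : ∃ f : ℝ[X], f ≠ 0 ∧ f.natDegree ≤ d ∧ l (f * f) = 0
  · classical
    have hN : ∃ k, ∃ f : ℝ[X], f ≠ 0 ∧ f.natDegree ≤ d ∧ l (f * f) = 0 ∧ f.natDegree = k := by
      obtain ⟨f, h1, h2, h3⟩ := hK
      exact ⟨_, f, h1, h2, h3, rfl⟩
    -- A null polynomial of least degree generates. Stability under `X` makes `X ^ j * g` null;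
    -- stability under division by `X` and minimality force `g 0 ≠ 0`.
    obtain ⟨g, hg0, hgd, hgl, hgk⟩ := Nat.find_spec hN
    have hmin : ∀ f : ℝ[X], f ≠ 0 → f.natDegree < g.natDegree → 0 < l (f * f) := by
      intro f hf hlt
      refine lt_of_le_of_ne (hpos f (by omega)) fun h0 => ?_
      exact Nat.find_min hN (m := f.natDegree) (by omega) ⟨f, hf, by omega, h0.symm, rfl⟩
    have hX : ∀ j, j + g.natDegree ≤ d → l ((X ^ j * g) * (X ^ j * g)) = 0 := by
      intro j
      induction j with
      | zero => intro _; simpa using hgl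
      | succ j ih =>
        intro hj
        have := hup (X ^ j * g) (by
          rw [natDegree_mul (pow_ne_zero _ X_ne_zero) hg0, natDegree_X_pow]; omega)
          (ih (by omega))
        rw [pow_succ']
        simpa only [mul_assoc] using this
    have hz : g.eval 0 ≠ 0 := by
      intro h0
      obtain ⟨q, rfl⟩ : X ∣ g := by rwa [X_dvd_iff, coeff_zero_eq_eval_zero]
      have hq : q ≠ 0 := right_ne_zero_of_mul hg0
      have hdq : (X * q).natDegree = q.natDegree + 1 := natDegree_X_mul hq
      exact (hmin q hq (by omega)).ne' (hdown q (by omega) hgl)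
    have hmono : ∀ j, j + g.natDegree ≤ 2 * d → l (g * X ^ j) = 0 := by
      intro j hj
      by_cases hjd : j ≤ d
      · exact horth g _ hgd (by simpa using hjd) hgl
      · have e : g * X ^ j = (X ^ (j - d) * g) * X ^ d := by
          rw [mul_right_comm, ← pow_add, Nat.sub_add_cancel (by omega), mul_comm]
        rw [e]
        refine horth _ _ ?_ (by simp) (hX _ (by omega))
        rw [natDegree_mul (pow_ne_zero _ X_ne_zero) hg0, natDegree_X_pow]
        omega
    have hgq : ∀ q : ℝ[X], (g * q).natDegree ≤ 2 * d → l (g * q) = 0 := by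
      intro q hq
      rcases eq_or_ne q 0 with rfl | hq0
      · simp
      rw [natDegree_mul hg0 hq0] at hq
      rw [q.as_sum_range_C_mul_X_pow, Finset.mul_sum, map_sum]
      refine Finset.sum_eq_zero fun j hj => ?_
      rw [Finset.mem_range] at hj
      rw [mul_left_comm, ← smul_eq_C_mul, map_smul, hmono j (by omega), smul_zero]
    obtain ⟨S, w, h1, h2, h3, h4⟩ := exists_quadrature_of_generator l hg0 (d := d) (by omega) hz hgq
      hmin
    exact ⟨S, w, h1, by omega, fun _ => by omega, h3, h4⟩
  · have hpd : ∀ f : ℝ[X], f ≠ 0 → f.natDegree ≤ d → 0 < l (f * f) := fun f hf hfd =>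
      lt_of_le_of_ne (hpos f hfd) fun h0 => hK ⟨f, hf, hfd, h0.symm⟩
    have hrep : ∀ φ : ℝ[X] →ₗ[ℝ] ℝ, ∃ f : ℝ[X], f.natDegree ≤ d ∧
        ∀ q : ℝ[X], q.natDegree ≤ d → l (f * q) = φ q := by
      intro φ
      obtain ⟨f, hf, hf'⟩ := exists_represents_weighted l 1 d φ (by
        intro f hf h0
        rcases eq_or_ne f 0 with rfl | hf0
        · simp
        · simp only [one_mul] at h0
          exact absurd h0 (hpd f hf0 hf).ne')
      exact ⟨f, hf, fun q hq => by simpa using hf' q hq⟩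
    -- Definite case: `X ^ (d + 1) - h` is orthogonal to all degrees up to `d`, and `k` only to
    -- degrees below `d`, which is all the quadrature needs. Adding `k` is the freedom used to move
    -- a root away from `0`.
    obtain ⟨h, hh, hh'⟩ := hrep (l.comp (LinearMap.mulLeft ℝ (X ^ (d + 1))))
    obtain ⟨k, hk, hk'⟩ := hrep (lcoeff ℝ d)
    obtain ⟨g, hgm, hgd, hz, hgo⟩ : ∃ g : ℝ[X], g.Monic ∧ g.natDegree = d + 1 ∧ g.eval 0 ≠ 0 ∧
        ∀ q : ℝ[X], q.natDegree < d → l (g * q) = 0 := by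
      have hmon : ∀ r : ℝ[X], r.natDegree ≤ d →
          (X ^ (d + 1) + r).Monic ∧ (X ^ (d + 1) + r).natDegree = d + 1 := by
        intro r hr
        have hlt : r.degree < ((d + 1 : ℕ) : WithBot ℕ) :=
          (Polynomial.natDegree_le_iff_degree_le.1 hr).trans_lt
            (by exact_mod_cast Nat.lt_succ_self d)
        exact ⟨monic_X_pow_add hlt, natDegree_eq_of_degree_eq_some (by
            rw [degree_add_eq_left_of_degree_lt (by rwa [degree_X_pow]), degree_X_pow])⟩
      have h0 : ∀ q : ℝ[X], q.natDegree ≤ d → l ((X ^ (d + 1) + -h) * q) = 0 := by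
        intro q hq
        rw [add_mul, map_add, neg_mul, map_neg, hh' q hq]
        simp
      by_cases hz : (X ^ (d + 1) + -h).eval 0 = 0
      · have hz' : (X ^ (d + 1) + (-h + k)).eval 0 ≠ 0 := by
          intro hz2
          have hk0 : k.eval 0 = 0 := by
            rw [← add_assoc, eval_add, hz, zero_add] at hz2
            exact hz2
          obtain ⟨k1, rfl⟩ : X ∣ k := by rwa [X_dvd_iff, coeff_zero_eq_eval_zero]
          obtain ⟨g1, hg1⟩ : X ∣ (X ^ (d + 1) + -h) := by
            rwa [X_dvd_iff, coeff_zero_eq_eval_zero]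
          obtain ⟨hm1, hm2⟩ := hmon (-h) (by simpa using hh)
          have hg10 : g1 ≠ 0 := by
            rintro rfl
            rw [hg1] at hm2
            simp at hm2
          have hk1 : k1.natDegree ≤ d := by
            rcases eq_or_ne k1 0 with rfl | hk10
            · simp
            · rw [natDegree_X_mul hk10] at hk; omega
          have hg1d : g1.natDegree = d := by
            rw [hg1, natDegree_X_mul hg10] at hm2; omega
          have e1 := h0 k1 hk1
          have e2 := hk' g1 hg1d.le
          -- If the orthogonal polynomial `X * g1` and `k = X * k1` both vanished at `0`, the same
          -- product would have `l`-value `0` by orthogonality and `1`, the leading coefficient of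
          -- `g1`, by the choice of `k`.
          have e3 : (X ^ (d + 1) + -h) * k1 = X * k1 * g1 := by rw [hg1]; ring
          rw [e3, e2] at e1
          rw [hg1] at hm1
          have : g1.leadingCoeff = 1 := by
            have := hm1.leadingCoeff
            rwa [leadingCoeff_mul, leadingCoeff_X, one_mul] at this
          rw [leadingCoeff, hg1d] at this
          rw [lcoeff_apply, this] at e1
          exact one_ne_zero e1
        have hr : (-h + k).natDegree ≤ d :=
          (natDegree_add_le _ _).trans (max_le (by simpa using hh) hk)
        refine ⟨_, (hmon _ hr).1, (hmon _ hr).2, hz', fun q hq => ?_⟩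
        rw [← add_assoc, add_mul, map_add, h0 q hq.le, hk' q hq.le, lcoeff_apply, zero_add]
        exact coeff_eq_zero_of_natDegree_lt hq
      · obtain ⟨hm1, hm2⟩ := hmon (-h) (by simpa using hh)
        exact ⟨_, hm1, hm2, hz, fun q hq => h0 q hq.le⟩
    have hg0 := hgm.ne_zero
    obtain ⟨S, w, h1, h2, h3, h4⟩ := exists_quadrature_of_generator l hg0 (d := d) (by omega) hz
      (by
        intro q hq
        rcases eq_or_ne q 0 with rfl | hq0
        · simp
        rw [natDegree_mul hg0 hq0] at hq
        exact hgo q (by omega))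
      (fun f hf hlt => hpd f hf (by omega))
    exact ⟨S, w, h1, by omega, fun hc => absurd hc hK, h3, h4⟩

end TruncMoment

/-! ### Splitting off mass at the crossing of two lines -/

namespace TruncMoment

open Polynomial

/-- The functional `l` minus the mass `c` at the origin. -/
noncomputable def removeMass (l : ℝ[X] →ₗ[ℝ] ℝ) (c : ℝ) : ℝ[X] →ₗ[ℝ] ℝ := l - c • leval 0

/-- A functional on the polynomials of one variable, positive in degree `2 * n`, whose kernel among
the multiples of `X` is stable under multiplication by `X`. The polynomial `f` minimizes
`l (f * f)` subject to `f 0 = 1`, and `l (f * f)` is the largest mass at `0` that can be split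
off. -/
theorem exists_axis_quadrature (l : ℝ[X] →ₗ[ℝ] ℝ) {n : ℕ} (hn : 1 ≤ n)
    (hpos : ∀ f : ℝ[X], f.natDegree ≤ n → 0 ≤ l (f * f))
    (hrec : ∀ f : ℝ[X], f.natDegree < n → f.eval 0 = 0 → l (f * f) = 0 →
      l ((X * f) * (X * f)) = 0) :
    ∃ f : ℝ[X], f.natDegree ≤ n ∧ f.eval 0 = 1 ∧
      ((∃ (S : Finset ℝ) (w : ℝ → ℝ), (0 : ℝ) ∉ S ∧ S.card ≤ n ∧ (∀ s ∈ S, 0 < w s) ∧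
          ∀ a : ℝ[X], a.natDegree ≤ 2 * n →
            l a = ∑ s ∈ S, w s * a.eval s + l (f * f) * a.eval 0) ∨
        (f.natDegree < n ∧ l ((X * f) * (X * f)) ≠ 0 ∧ ∀ c < l (f * f),
          ∃ (S : Finset ℝ) (w : ℝ → ℝ), (0 : ℝ) ∉ S ∧ S.card ≤ n + 1 ∧ (∀ s ∈ S, 0 < w s) ∧
          ∀ a : ℝ[X], a.natDegree ≤ 2 * n →
            l a = ∑ s ∈ S, w s * a.eval s + c * a.eval 0)) := by
  obtain ⟨k, rfl⟩ : ∃ k, n = k + 1 := ⟨n - 1, by omega⟩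
  have horth : ∀ f g : ℝ[X], f.natDegree ≤ k + 1 → g.natDegree ≤ k + 1 → l (f * f) = 0 →
      l (f * g) = 0 :=
    fun f g hf hg h0 => map_mul_eq_zero_of_null l (degreeLT ℝ (k + 1 + 1))
      (fun f hf => hpos f (mem_degreeLT_succ.1 hf)) (mem_degreeLT_succ.2 hf)
      (mem_degreeLT_succ.2 hg) h0
  have hnull : ∀ (t : ℝ) (f g : ℝ[X]), f.natDegree ≤ k + 1 → g.natDegree ≤ k + 1 →
      l (f * f) = 0 → l (g * g) = 0 → l ((t • f + g) * (t • f + g)) = 0 :=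
    fun t f g hf hg h1 h2 => null_smul_add l (degreeLT ℝ (k + 1 + 1))
      (fun f hf => hpos f (mem_degreeLT_succ.1 hf)) t (mem_degreeLT_succ.2 hf)
      (mem_degreeLT_succ.2 hg) h1 h2
  have hXdvd : ∀ f : ℝ[X], f.natDegree ≤ k + 1 → f.eval 0 = 0 →
      ∃ q : ℝ[X], q.natDegree ≤ k ∧ f = X * q := by
    intro f hf h0
    obtain ⟨q, rfl⟩ : X ∣ f := by rwa [X_dvd_iff, coeff_zero_eq_eval_zero]
    refine ⟨q, ?_, rfl⟩
    rcases eq_or_ne q 0 with rfl | hq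
    · simp
    · rw [natDegree_X_mul hq] at hf; omega
  -- The stationarity condition for minimizing `l (f * f)` subject to `f 0 = 1`. Below, `f` is a
  -- minimizer of least degree.
  let valid : ℝ[X] → Prop := fun f => f.natDegree ≤ k + 1 ∧ f.eval 0 = 1 ∧
    ∀ g : ℝ[X], g.natDegree ≤ k + 1 → g.eval 0 = 0 → l (f * g) = 0
  have hex : ∃ d, ∃ f, valid f ∧ f.natDegree = d := by
    obtain ⟨q, hq, hq'⟩ := exists_represents_weighted l X k (-(l.comp (LinearMap.mulLeft ℝ X))) (by
      intro f hf h0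
      have := horth (X * f) 1 (natDegree_X_mul_le hf) (by simp) h0
      rw [mul_one] at this
      simp [this])
    refine ⟨_, 1 + X * q, ⟨?_, by simp, ?_⟩, rfl⟩
    · exact (natDegree_add_le _ _).trans (max_le (by simp) (natDegree_X_mul_le hq))
    · intro g hg h0
      obtain ⟨r, hr, rfl⟩ := hXdvd g hg h0
      rw [add_mul, map_add, hq' r hr]
      simp
  classical
  obtain ⟨f, ⟨hfd, hf0, hf⟩, hfk⟩ := Nat.find_spec hex
  have hmin : ∀ g, valid g → f.natDegree ≤ g.natDegree := by
    intro g hg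
    rw [hfk]
    exact Nat.find_min' hex ⟨g, hg, rfl⟩
  have hrem : ∀ g : ℝ[X], g.natDegree ≤ k + 1 → (g - C (g.eval 0) * f).natDegree ≤ k + 1 :=
    fun g hg => (natDegree_sub_le _ _).trans (max_le hg ((natDegree_C_mul_le _ _).trans hfd))
  have hrem0 : ∀ g : ℝ[X], (g - C (g.eval 0) * f).eval 0 = 0 := fun g => by simp [hf0]
  -- Orthogonal splitting of `g` along `f`: removing mass `c ≤ l (f * f)` at `0` preserves
  -- positivity.
  have hsplit : ∀ g : ℝ[X], g.natDegree ≤ k + 1 → l (g * g) = g.eval 0 ^ 2 * l (f * f) +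
      l ((g - C (g.eval 0) * f) * (g - C (g.eval 0) * f)) := by
    intro g hg
    have h1 := hf _ (hrem g hg) (hrem0 g)
    have e : g * g = g.eval 0 ^ 2 • (f * f) +
        ((g - C (g.eval 0) * f) * (g - C (g.eval 0) * f)) +
        (2 * g.eval 0) • (f * (g - C (g.eval 0) * f)) := by
      simp only [smul_eq_C_mul, C_mul, C_pow, map_ofNat]
      ring
    conv_lhs => rw [e]
    rw [map_add, map_add, map_smul, map_smul, h1]
    simp
  have hl' : ∀ (c : ℝ) (p : ℝ[X]), (removeMass l c) p = l p - c * p.eval 0 := fun c p => by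
    simp [removeMass]
  have hX0 : ∀ (c : ℝ) (p : ℝ[X]), (removeMass l c) ((X * p) * (X * p)) = l ((X * p) * (X * p)) :=
    fun c p => by rw [hl']; simp
  have hpos' : ∀ c ≤ l (f * f), ∀ g : ℝ[X], g.natDegree ≤ k + 1 →
      0 ≤ (removeMass l c) (g * g) := by
    intro c hc g hg
    rw [hl', hsplit g hg, eval_mul]
    nlinarith [hpos _ (hrem g hg), mul_nonneg (sq_nonneg (g.eval 0)) (sub_nonneg.2 hc)]
  refine ⟨f, hfd, hf0, ?_⟩
  -- After the maximal mass is removed, `f` itself becomes null. The condition says that this new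
  -- null vector does not violate stability under `X`.
  by_cases hgood : f.natDegree < k + 1 → l ((X * f) * (X * f)) = 0
  · left
    have hzero : ∀ g : ℝ[X], g.natDegree ≤ k + 1 → (removeMass l (l (f * f))) (g * g) =
        l ((g - C (g.eval 0) * f) * (g - C (g.eval 0) * f)) := by
      intro g hg
      rw [hl', hsplit g hg, eval_mul]
      ring
    obtain ⟨S, w, h1, _, h3, h4, h5⟩ := exists_quadrature (removeMass l (l (f * f))) (k + 1)
      (hpos' _ le_rfl)
      (by
        intro g hg h0
        rw [hX0]
        rw [hzero g hg.le] at h0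
        rcases eq_or_ne (g.eval 0) 0 with hg0 | hg0
        · rw [hg0, C_0, zero_mul, sub_zero] at h0
          exact hrec g hg hg0 h0
        · have hval : valid (C (g.eval 0)⁻¹ * g) := by
            refine ⟨(natDegree_C_mul_le _ _).trans hg.le, by simp [hg0], fun p hp hp0 => ?_⟩
            have e : C (g.eval 0)⁻¹ * g * p =
                (g.eval 0)⁻¹ • ((g - C (g.eval 0) * f) * p + g.eval 0 • (f * p)) := by
              simp only [smul_eq_C_mul]
              ring
            rw [e, map_smul, map_add, map_smul, horth _ p (hrem g hg.le) hp h0, hf p hp hp0]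
            simp
          -- Least degree of `f` keeps `g - C (g.eval 0) * f` below degree `n`, where `hrec`
          -- applies.
          have hfg : f.natDegree ≤ g.natDegree := (hmin _ hval).trans (natDegree_C_mul_le _ _)
          have hd : (g - C (g.eval 0) * f).natDegree < k + 1 :=
            ((natDegree_sub_le _ _).trans
              (max_le le_rfl ((natDegree_C_mul_le _ _).trans hfg))).trans_lt hg
          have h2 := hrec _ hd (hrem0 g) h0
          have h3 := hnull (g.eval 0) (X * f) (X * (g - C (g.eval 0) * f))
            (natDegree_X_mul_le (by omega)) (natDegree_X_mul_le (by omega))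
            (hgood (by omega)) h2
          have e : g.eval 0 • (X * f) + X * (g - C (g.eval 0) * f) = X * g := by
            rw [smul_eq_C_mul]; ring
          rwa [e] at h3)
      (by
        intro g hg h0
        rw [hX0] at h0
        rw [hzero g hg.le]
        obtain ⟨q, hq, hq'⟩ := hXdvd _ (hrem g hg.le) (hrem0 g)
        have h1 := horth (X * g) q (natDegree_X_mul_le (by omega)) (by omega) h0
        have h2 := hf _ (hrem g hg.le) (hrem0 g)
        have e : (g - C (g.eval 0) * f) * (g - C (g.eval 0) * f) =
            X * g * q + (-g.eval 0) • (f * (g - C (g.eval 0) * f)) := by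
          have : X * g * q = g * (g - C (g.eval 0) * f) := by rw [hq']; ring
          rw [this, smul_eq_C_mul, C_neg]
          ring
        rw [e, map_add, map_smul, h1, h2]
        simp)
    -- The null vector `f` lowers the bound on the number of nodes from `n + 1` to `n`.
    refine ⟨S, w, h1, h3 ⟨f, ?_, hfd, ?_⟩, h4, fun a ha => ?_⟩
    · rintro rfl
      simp at hf0
    · rw [hl', eval_mul, hf0]; ring
    · rw [← h5 a ha, hl']; ring
  · right
    rw [not_forall] at hgood
    obtain ⟨hlt, hne⟩ := hgood
    refine ⟨hlt, hne, ?_⟩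
    -- A nonzero `h` of least degree with `X * h` null has `h 0 ≠ 0`, so its normalization `f'` is
    -- another minimizer. Then `f' - f` is null and vanishes at `0`, `hrec` makes `X * (f' - f)`
    -- null, and so `X * f` is null, a contradiction.
    have hker : ∀ h : ℝ[X], h.natDegree ≤ k → l ((X * h) * (X * h)) = 0 → h = 0 := by
      by_contra! hc
      have hex : ∃ d, ∃ h : ℝ[X], h.natDegree ≤ k ∧ l ((X * h) * (X * h)) = 0 ∧ h ≠ 0 ∧
          h.natDegree = d := by
        obtain ⟨h, h1, h2, h3⟩ := hc
        exact ⟨_, h, h1, h2, h3, rfl⟩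
      obtain ⟨h, hhk, hh, hh0, hhd⟩ := Nat.find_spec hex
      have hz : h.eval 0 ≠ 0 := by
        intro h0
        obtain ⟨q, rfl⟩ : X ∣ h := by rwa [X_dvd_iff, coeff_zero_eq_eval_zero]
        have hq : q ≠ 0 := right_ne_zero_of_mul hh0
        have hdq : (X * q).natDegree = q.natDegree + 1 := natDegree_X_mul hq
        refine Nat.find_min hex (m := q.natDegree) (by omega) ⟨q, by omega, ?_, hq, rfl⟩
        have := horth (X * (X * q)) q (natDegree_X_mul_le (by omega)) (by omega) hh
        rw [← this]
        congr 1
        ring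
      have hval : valid (C (h.eval 0)⁻¹ * h) := by
        refine ⟨(natDegree_C_mul_le _ _).trans (by omega), by simp [hz], fun p hp hp0 => ?_⟩
        obtain ⟨q, hq, rfl⟩ := hXdvd p hp hp0
        have e : C (h.eval 0)⁻¹ * h * (X * q) = (h.eval 0)⁻¹ • (X * h * q) := by
          rw [smul_eq_C_mul]; ring
        rw [e, map_smul, horth _ q (natDegree_X_mul_le hhk) (by omega) hh, smul_zero]
      set f' := C (h.eval 0)⁻¹ * h with hf'
      have hf'd : f'.natDegree ≤ k := (natDegree_C_mul_le _ _).trans hhk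
      have hd : (f' - f).natDegree ≤ k :=
        (natDegree_sub_le _ _).trans (max_le hf'd (by omega))
      have hd0 : (f' - f).eval 0 = 0 := by rw [eval_sub, hval.2.1, hf0, sub_self]
      have h1 : l ((f' - f) * (f' - f)) = 0 := by
        rw [sub_mul, map_sub, hval.2.2 _ (by omega) hd0, hf _ (by omega) hd0, sub_zero]
      have h2 := hrec _ (by omega) hd0 h1
      have h3 : l ((X * f') * (X * f')) = 0 := by
        have e : (X * f') * (X * f') = ((h.eval 0)⁻¹ ^ 2) • ((X * h) * (X * h)) := by
          rw [smul_eq_C_mul, hf', C_pow]; ring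
        rw [e, map_smul, hh, smul_zero]
      have h4 := hnull (-1) (X * (f' - f)) (X * f') (natDegree_X_mul_le hd)
        (natDegree_X_mul_le hf'd) h2 h3
      apply hne
      have e : (-1 : ℝ) • (X * (f' - f)) + X * f' = X * f := by
        rw [neg_one_smul]; ring
      rwa [e] at h4
    intro c hc
    -- Below the maximal mass the remaining form is definite, so the stability conditions hold
    -- trivially.
    have hpd : ∀ g : ℝ[X], g.natDegree ≤ k + 1 → (removeMass l c) (g * g) = 0 → g = 0 := by
      intro g hg h0
      rw [hl', hsplit g hg, eval_mul] at h0
      have h1 := hpos _ (hrem g hg)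
      have h2 : g.eval 0 = 0 := by
        by_contra hg0
        have := mul_pos (pow_pos (abs_pos.2 hg0) 2) (sub_pos.2 hc)
        rw [sq_abs] at this
        nlinarith
      rw [h2, C_0, zero_mul, sub_zero] at h0
      obtain ⟨q, hq, rfl⟩ := hXdvd g hg h2
      rw [hker q hq (by linarith), mul_zero]
    obtain ⟨S, w, h1, h2, _, h4, h5⟩ := exists_quadrature (removeMass l c) (k + 1)
      (hpos' c hc.le)
      (fun g hg h0 => by rw [hpd g hg.le h0]; simp)
      (fun g hg h0 => by
        have := hpd (X * g) (natDegree_X_mul_le (by omega)) h0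
        rw [(mul_eq_zero.1 this).resolve_left X_ne_zero]; simp)
    exact ⟨S, w, h1, h2, h4, fun a ha => by rw [← h5 a ha, hl']; ring⟩

/-- The truncated moment problem on two lines crossing at the origin of both. A polynomial function
on their union is a pair `(a, b)` with `a 0 = b 0`. -/
theorem exists_cross_quadrature (l m : ℝ[X] →ₗ[ℝ] ℝ) {n : ℕ} (hn : 1 ≤ n) (hlm : l 1 = m 1)
    (hpos : ∀ a b : ℝ[X], a.natDegree ≤ n → b.natDegree ≤ n → a.eval 0 = b.eval 0 →
      0 ≤ l (a * a) + m (b * b) - l 1 * a.eval 0 ^ 2)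
    (hrec : ∀ a b : ℝ[X], a.natDegree ≤ n → b.natDegree ≤ n → a.eval 0 = b.eval 0 →
      l (a * a) + m (b * b) - l 1 * a.eval 0 ^ 2 = 0 →
      (a.natDegree < n → l ((X * a) * (X * a)) = 0) ∧
      (b.natDegree < n → m ((X * b) * (X * b)) = 0)) :
    ∃ (S T : Finset ℝ) (w w' : ℝ → ℝ) (e : ℝ), (0 : ℝ) ∉ S ∧ (0 : ℝ) ∉ T ∧ 0 ≤ e ∧
      (∀ s ∈ S, 0 < w s) ∧ (∀ t ∈ T, 0 < w' t) ∧
      ((S.card ≤ n ∧ T.card ≤ n) ∨ (e = 0 ∧ S.card ≤ n + 1 ∧ T.card ≤ n + 1)) ∧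
      ∀ a b : ℝ[X], a.natDegree ≤ 2 * n → b.natDegree ≤ 2 * n → a.eval 0 = b.eval 0 →
        l a + m b - l 1 * a.eval 0 =
          ∑ s ∈ S, w s * a.eval s + ∑ t ∈ T, w' t * b.eval t + e * a.eval 0 := by
  have hlC : ∀ c : ℝ, l (C c) = l 1 * c := fun c => by
    rw [← mul_one (C c), ← smul_eq_C_mul, map_smul, smul_eq_mul, mul_comm]
  have hmC : ∀ c : ℝ, m (C c) = l 1 * c := fun c => by
    rw [← mul_one (C c), ← smul_eq_C_mul, map_smul, smul_eq_mul, mul_comm, hlm]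
  obtain ⟨f, hfd, hf0, hf⟩ := exists_axis_quadrature l hn
    (fun a ha => by
      -- Extending `a` by a constant along the other line makes the correction `l 1 * a.eval 0 ^ 2`
      -- cancel.
      have := hpos a (C (a.eval 0)) ha (by simp) (by simp)
      rw [← C_mul, hmC] at this
      linarith)
    (fun a ha ha0 h0 => (hrec a 0 ha.le (by simp) (by simpa using ha0)
      (by simp [h0, ha0])).1 ha)
  obtain ⟨g, hgd, hg0, hg⟩ := exists_axis_quadrature m hn
    (fun b hb => by
      have := hpos (C (b.eval 0)) b (by simp) hb (by simp)
      rw [← C_mul, hlC] at this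
      simp only [eval_C] at this
      linarith)
    (fun b hb hb0 h0 => (hrec 0 b (by simp) hb.le (by simpa using hb0.symm)
      (by simp [h0])).2 hb)
  have he := hpos f g hfd hgd (by rw [hf0, hg0])
  have hr := hrec f g hfd hgd (by rw [hf0, hg0])
  rw [hf0, one_pow, mul_one] at he hr
  -- If the maximal masses had no excess over `l 1`, the pair `(f, g)` would be null and coupled
  -- recursiveness would exclude the bad case. The strict excess leaves room for masses below the
  -- maximum, with sum exactly `l 1` and no atom at the origin.
  have hepos : (f.natDegree < n ∧ l ((X * f) * (X * f)) ≠ 0) ∨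
      (g.natDegree < n ∧ m ((X * g) * (X * g)) ≠ 0) →
      0 < l (f * f) + m (g * g) - l 1 := by
    intro h
    refine lt_of_le_of_ne he fun h0 => ?_
    rcases h with ⟨h1, h2⟩ | ⟨h1, h2⟩
    · exact h2 ((hr h0.symm).1 h1)
    · exact h2 ((hr h0.symm).2 h1)
  rcases hf with ⟨S, w, hS0, hS, hw, hSw⟩ | ⟨hf1, hf2, hf3⟩
  · rcases hg with ⟨T, w', hT0, hT, hw', hTw⟩ | ⟨hg1, hg2, hg3⟩
    · refine ⟨S, T, w, w', _, hS0, hT0, he, hw, hw', Or.inl ⟨hS, hT⟩, fun a b ha hb hab => ?_⟩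
      rw [hSw a ha, hTw b hb, ← hab]
      ring
    · have := hepos (Or.inr ⟨hg1, hg2⟩)
      obtain ⟨T, w', hT0, hT, hw', hTw⟩ := hg3 (l 1 - l (f * f)) (by linarith)
      refine ⟨S, T, w, w', 0, hS0, hT0, le_rfl, hw, hw', Or.inr ⟨rfl, by omega, hT⟩,
        fun a b ha hb hab => ?_⟩
      rw [hSw a ha, hTw b hb, ← hab]
      ring
  · rcases hg with ⟨T, w', hT0, hT, hw', hTw⟩ | ⟨hg1, hg2, hg3⟩
    · have := hepos (Or.inl ⟨hf1, hf2⟩)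
      obtain ⟨S, w, hS0, hS, hw, hSw⟩ := hf3 (l 1 - m (g * g)) (by linarith)
      refine ⟨S, T, w, w', 0, hS0, hT0, le_rfl, hw, hw', Or.inr ⟨rfl, hS, by omega⟩,
        fun a b ha hb hab => ?_⟩
      rw [hSw a ha, hTw b hb, ← hab]
      ring
    · have := hepos (Or.inl ⟨hf1, hf2⟩)
      obtain ⟨S, w, hS0, hS, hw, hSw⟩ :=
        hf3 (l (f * f) - (l (f * f) + m (g * g) - l 1) / 2) (by linarith)
      obtain ⟨T, w', hT0, hT, hw', hTw⟩ :=
        hg3 (m (g * g) - (l (f * f) + m (g * g) - l 1) / 2) (by linarith)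
      refine ⟨S, T, w, w', 0, hS0, hT0, le_rfl, hw, hw', Or.inr ⟨rfl, hS, hT⟩,
        fun a b ha hb hab => ?_⟩
      rw [hSw a ha, hTw b hb, ← hab]
      ring

end TruncMoment

/-! ### The Riesz functional, column relations and rank -/

namespace TruncMoment

open MvPolynomial

/-- The polynomials of degree at most `n` in two variables. -/
noncomputable abbrev polysLE (n : ℕ) : Submodule ℝ (MvPolynomial (Fin 2) ℝ) :=
  restrictTotalDegree (Fin 2) ℝ n

theorem mem_polysLE {n : ℕ} {p : MvPolynomial (Fin 2) ℝ} :
    p ∈ polysLE n ↔ p.totalDegree ≤ n :=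
  mem_restrictTotalDegree _ _ _

theorem mul_mem_polysLE {m n : ℕ} {p q : MvPolynomial (Fin 2) ℝ} (hp : p ∈ polysLE m)
    (hq : q ∈ polysLE n) : p * q ∈ polysLE (m + n) := by
  rw [mem_polysLE] at *
  exact (totalDegree_mul _ _).trans (add_le_add hp hq)

theorem polysLE_mono {m n : ℕ} (h : m ≤ n) : polysLE m ≤ polysLE n := fun p hp => by
  rw [mem_polysLE] at *
  exact hp.trans h

/-- The exponent of the monomial `y ^ a.1 * x ^ a.2`. -/
noncomputable def expo (a : ℕ × ℕ) : Fin 2 →₀ ℕ := Finsupp.single 0 a.2 + Finsupp.single 1 a.1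

@[simp] theorem expo_zero (a : ℕ × ℕ) : expo a 0 = a.2 := by simp [expo]

@[simp] theorem expo_one (a : ℕ × ℕ) : expo a 1 = a.1 := by simp [expo]

theorem expo_apply (m : Fin 2 →₀ ℕ) : expo (m 1, m 0) = m := by
  ext i
  fin_cases i <;> simp

theorem expo_injective : Function.Injective expo := by
  intro a b h
  have h0 := DFunLike.congr_fun h 0
  have h1 := DFunLike.congr_fun h 1
  simp only [expo_zero, expo_one] at h0 h1
  exact Prod.ext h1 h0

theorem degree_eq (m : Fin 2 →₀ ℕ) : (m.sum fun _ e => e) = m 0 + m 1 := by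
  rw [Finsupp.sum_fintype _ _ (fun _ => rfl), Fin.sum_univ_two]

theorem monomial_mem_polysLE {m : Fin 2 →₀ ℕ} {c : ℝ} {n : ℕ} (h : m 0 + m 1 ≤ n) :
    monomial m c ∈ polysLE n := by
  rw [mem_polysLE]
  refine (totalDegree_monomial_le _ _).trans ?_
  change (m.sum fun _ e => e) ≤ n
  rwa [degree_eq]

/-- A subspace contains all polynomials of degree at most `n` if it contains the monomials. -/
theorem polysLE_le {n : ℕ} {M : Submodule ℝ (MvPolynomial (Fin 2) ℝ)}
    (h : ∀ m : Fin 2 →₀ ℕ, m 0 + m 1 ≤ n → monomial m (1 : ℝ) ∈ M) : polysLE n ≤ M := by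
  intro p hp
  rw [mem_polysLE] at hp
  rw [p.as_sum]
  refine M.sum_mem fun m hm => ?_
  have := (le_totalDegree hm).trans hp
  rw [degree_eq] at this
  have h1 := M.smul_mem (coeff m p) (h m this)
  rwa [smul_monomial, smul_eq_mul, mul_one] at h1

/-- The Riesz functional of `β`, which maps `y ^ i * x ^ j` to `β i j`. -/
noncomputable def riesz (β : ℕ → ℕ → ℝ) : MvPolynomial (Fin 2) ℝ →ₗ[ℝ] ℝ :=
  (basisMonomials (Fin 2) ℝ).constr ℝ fun m => β (m 1) (m 0)

theorem riesz_monomial (β : ℕ → ℕ → ℝ) (m : Fin 2 →₀ ℕ) (c : ℝ) :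
    riesz β (monomial m c) = c * β (m 1) (m 0) := by
  have h1 : riesz β (monomial m 1) = β (m 1) (m 0) := by
    have := (basisMonomials (Fin 2) ℝ).constr_basis ℝ (fun m => β (m 1) (m 0)) m
    rwa [coe_basisMonomials] at this
  rw [← mul_one c, ← smul_eq_mul, ← smul_monomial, map_smul, h1]
  simp

/-- The polynomial with a given vector of coefficients. -/
noncomputable def ofCoeffs (n : ℕ) : (monomials n → ℝ) →ₗ[ℝ] MvPolynomial (Fin 2) ℝ :=
  Fintype.linearCombination ℝ fun a : monomials n => monomial (expo a.1) (1 : ℝ)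

theorem ofCoeffs_apply (n : ℕ) (x : monomials n → ℝ) :
    ofCoeffs n x = ∑ a, monomial (expo a.1) (x a) := by
  simp [ofCoeffs, Fintype.linearCombination_apply, smul_monomial]

theorem ofCoeffs_mem (n : ℕ) (x : monomials n → ℝ) : ofCoeffs n x ∈ polysLE n := by
  rw [ofCoeffs_apply]
  refine Submodule.sum_mem _ fun a _ => monomial_mem_polysLE ?_
  have := mem_monomials.1 a.2
  simp only [expo_zero, expo_one]
  omega

theorem coeffVec_ofCoeffs (n : ℕ) (x : monomials n → ℝ) : coeffVec n (ofCoeffs n x) = x := by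
  ext a
  change coeff (expo a.1) (ofCoeffs n x) = x a
  rw [ofCoeffs_apply, coeff_sum, Finset.sum_eq_single_of_mem a (Finset.mem_univ a)]
  · simp
  · intro b _ hb
    rw [coeff_monomial, if_neg]
    exact fun h => hb (Subtype.ext (expo_injective h))

theorem ofCoeffs_coeffVec {n : ℕ} {p : MvPolynomial (Fin 2) ℝ} (hp : p ∈ polysLE n) :
    ofCoeffs n (coeffVec n p) = p := by
  have : polysLE n ≤ LinearMap.range (ofCoeffs n) := by
    refine polysLE_le fun m hm => ?_
    have hmem : (m 1, m 0) ∈ monomials n := mem_monomials.2 (by simp only; omega)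
    refine ⟨Pi.single ⟨(m 1, m 0), hmem⟩ 1, ?_⟩
    rw [ofCoeffs, Fintype.linearCombination_apply_single, one_smul, expo_apply]
  obtain ⟨x, rfl⟩ := this hp
  rw [coeffVec_ofCoeffs]

theorem riesz_ofCoeffs_mul (n : ℕ) (β : ℕ → ℕ → ℝ) (x y : monomials n → ℝ) :
    riesz β (ofCoeffs n x * ofCoeffs n y) = x ⬝ᵥ (momentMatrix n β).mulVec y := by
  rw [ofCoeffs_apply, ofCoeffs_apply, Finset.sum_mul_sum, map_sum]
  refine Finset.sum_congr rfl fun a _ => ?_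
  rw [map_sum, Matrix.mulVec, dotProduct, Finset.mul_sum]
  refine Finset.sum_congr rfl fun b _ => ?_
  rw [monomial_mul, riesz_monomial]
  simp [momentMatrix]
  ring

theorem momentMatrix_isSymm (n : ℕ) (β : ℕ → ℕ → ℝ) : (momentMatrix n β).IsHermitian := by
  ext a b
  simp [momentMatrix, add_comm]

theorem posSemidef_iff {n : ℕ} {β : ℕ → ℕ → ℝ} :
    (momentMatrix n β).PosSemidef ↔ ∀ p ∈ polysLE n, 0 ≤ riesz β (p * p) := by
  rw [Matrix.posSemidef_iff_dotProduct_mulVec]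
  constructor
  · rintro ⟨-, h⟩ p hp
    rw [← ofCoeffs_coeffVec hp, riesz_ofCoeffs_mul]
    simpa using h (coeffVec n p)
  · intro h
    refine ⟨momentMatrix_isSymm n β, fun x => ?_⟩
    have := h _ (ofCoeffs_mem n x)
    rw [riesz_ofCoeffs_mul] at this
    simpa using this

theorem column_ofCoeffs (n : ℕ) (β : ℕ → ℕ → ℝ) (x : monomials n → ℝ) :
    column n β (ofCoeffs n x) = (momentMatrix n β).mulVec x := by
  rw [column, coeffVec_ofCoeffs]

theorem column_eq_zero_iff {n : ℕ} {β : ℕ → ℕ → ℝ} {p : MvPolynomial (Fin 2) ℝ}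
    (hp : p ∈ polysLE n) : column n β p = 0 ↔ ∀ q ∈ polysLE n, riesz β (p * q) = 0 := by
  constructor
  · intro h q hq
    rw [mul_comm, ← ofCoeffs_coeffVec hp, ← ofCoeffs_coeffVec hq, riesz_ofCoeffs_mul]
    rw [column] at h
    rw [h, dotProduct_zero]
  · intro h
    -- The test polynomial has the column itself as its coefficient vector.
    rw [column, ← dotProduct_self_eq_zero, ← riesz_ofCoeffs_mul, ofCoeffs_coeffVec hp, mul_comm]
    exact h _ (ofCoeffs_mem n _)

theorem column_eq_zero_iff_sq {n : ℕ} {β : ℕ → ℕ → ℝ} (hpos : (momentMatrix n β).PosSemidef)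
    {p : MvPolynomial (Fin 2) ℝ} (hp : p ∈ polysLE n) :
    column n β p = 0 ↔ riesz β (p * p) = 0 := by
  rw [column_eq_zero_iff hp]
  exact ⟨fun h => h p hp, fun h q hq =>
    map_mul_eq_zero_of_null _ (polysLE n) (posSemidef_iff.1 hpos) hp hq h⟩

/-- Evaluation at a point `z = (x, y)` of the plane. -/
noncomputable abbrev evalAt (z : ℝ × ℝ) : MvPolynomial (Fin 2) ℝ →+* ℝ := eval ![z.1, z.2]

theorem evalAt_monomial (z : ℝ × ℝ) (m : Fin 2 →₀ ℕ) (c : ℝ) :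
    evalAt z (monomial m c) = c * (z.2 ^ m 1 * z.1 ^ m 0) := by
  rw [evalAt, eval_monomial, Finsupp.prod_fintype _ _ (fun i => pow_zero _), Fin.prod_univ_two]
  simp [mul_comm]

theorem continuous_evalAt (p : MvPolynomial (Fin 2) ℝ) : Continuous fun z => evalAt z p := by
  induction p using MvPolynomial.induction_on with
  | C a => simp only [evalAt, eval_C]; fun_prop
  | add p q hp hq => simp only [map_add]; fun_prop
  | mul_X p i hp =>
    simp only [map_mul, evalAt, eval_X]
    fin_cases i
    · exact hp.mul continuous_fst
    · exact hp.mul continuous_snd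

/-- The polynomials of degree at most `n` attain all values on `S`. -/
def Separates (n : ℕ) (S : Finset (ℝ × ℝ)) : Prop :=
  ∀ φ : ℝ × ℝ → ℝ, ∃ p ∈ polysLE n, ∀ z ∈ S, evalAt z p = φ z

theorem Separates.mono_degree {m n : ℕ} {S : Finset (ℝ × ℝ)} (h : Separates m S) (hmn : m ≤ n) :
    Separates n S := fun φ =>
  let ⟨p, hp, hp'⟩ := h φ
  ⟨p, polysLE_mono hmn hp, hp'⟩

/-- The values on `S` of the polynomial with given coefficients. -/
noncomputable def evalOn (n : ℕ) (S : Finset (ℝ × ℝ)) : (monomials n → ℝ) →ₗ[ℝ] (S → ℝ) :=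
  (LinearMap.pi fun z : S => (aeval ![z.1.1, z.1.2] : _ →ₐ[ℝ] ℝ).toLinearMap) ∘ₗ ofCoeffs n

theorem evalOn_apply (n : ℕ) (S : Finset (ℝ × ℝ)) (x : monomials n → ℝ) (z : S) :
    evalOn n S x z = evalAt z.1 (ofCoeffs n x) := rfl

theorem Separates.surjective {n : ℕ} {S : Finset (ℝ × ℝ)} (h : Separates n S) :
    LinearMap.range (evalOn n S) = ⊤ := by
  classical
  rw [LinearMap.range_eq_top]
  intro φ
  obtain ⟨p, hp, hp'⟩ := h fun z => if hz : z ∈ S then φ ⟨z, hz⟩ else 0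
  refine ⟨coeffVec n p, ?_⟩
  ext z
  rw [evalOn_apply, ofCoeffs_coeffVec hp, hp' z.1 z.2]
  simp

theorem rank_add_finrank_ker (n : ℕ) (β : ℕ → ℕ → ℝ) :
    (momentMatrix n β).rank + Module.finrank ℝ (LinearMap.ker (momentMatrix n β).mulVecLin) =
      Module.finrank ℝ (monomials n → ℝ) :=
  LinearMap.finrank_range_add_finrank_ker _

theorem ker_le_ker_evalOn {n : ℕ} {β : ℕ → ℕ → ℝ} {S : Finset (ℝ × ℝ)}
    (h : ∀ p ∈ polysLE n, column n β p = 0 → ∀ z ∈ S, evalAt z p = 0) :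
    LinearMap.ker (momentMatrix n β).mulVecLin ≤ LinearMap.ker (evalOn n S) := by
  intro x hx
  rw [LinearMap.mem_ker, Matrix.mulVecLin_apply, ← column_ofCoeffs] at hx
  rw [LinearMap.mem_ker]
  ext z
  exact h _ (ofCoeffs_mem n x) hx z.1 z.2

/-- The kernel of the matrix lies in that of evaluation on `S`, and separation gives evaluation full
rank. -/
theorem card_le_rank {n : ℕ} {β : ℕ → ℕ → ℝ} {S : Finset (ℝ × ℝ)} (hS : Separates n S)
    (h : ∀ p ∈ polysLE n, column n β p = 0 → ∀ z ∈ S, evalAt z p = 0) :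
    S.card ≤ (momentMatrix n β).rank := by
  have h1 := Submodule.finrank_mono (ker_le_ker_evalOn h)
  have h2 := LinearMap.finrank_range_add_finrank_ker (evalOn n S)
  rw [hS.surjective, finrank_top, Module.finrank_fintype_fun_eq_card, Fintype.card_coe] at h2
  have h3 := rank_add_finrank_ker n β
  omega

/-- The opposite inclusion of kernels; no separation is needed, as evaluation has rank at most
`S.card`. -/
theorem rank_le_card {n : ℕ} {β : ℕ → ℕ → ℝ} {S : Finset (ℝ × ℝ)}
    (h : ∀ p ∈ polysLE n, (∀ z ∈ S, evalAt z p = 0) → column n β p = 0) :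
    (momentMatrix n β).rank ≤ S.card := by
  have h0 : LinearMap.ker (evalOn n S) ≤ LinearMap.ker (momentMatrix n β).mulVecLin := by
    intro x hx
    rw [LinearMap.mem_ker, Matrix.mulVecLin_apply, ← column_ofCoeffs]
    refine h _ (ofCoeffs_mem n x) fun z hz => ?_
    rw [LinearMap.mem_ker] at hx
    exact congr_fun hx ⟨z, hz⟩
  have h1 := Submodule.finrank_mono h0
  have h2 := LinearMap.finrank_range_add_finrank_ker (evalOn n S)
  have h3 := rank_add_finrank_ker n β
  have h4 := Submodule.finrank_le (LinearMap.range (evalOn n S))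
  rw [Module.finrank_fintype_fun_eq_card, Fintype.card_coe] at h4
  omega

/-- If the variety contains at least `rank M(n)` points on which the polynomials of degree at most
`n` attain all values, then these points determine the column relations. -/
theorem column_eq_zero_of_rank_le {n : ℕ} {β : ℕ → ℕ → ℝ} {S : Finset (ℝ × ℝ)}
    (hS : Separates n S)
    (h : ∀ p ∈ polysLE n, column n β p = 0 → ∀ z ∈ S, evalAt z p = 0)
    (hr : (momentMatrix n β).rank ≤ S.card) {p : MvPolynomial (Fin 2) ℝ} (hp : p ∈ polysLE n)
    (hz : ∀ z ∈ S, evalAt z p = 0) : column n β p = 0 := by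
  have h2 := LinearMap.finrank_range_add_finrank_ker (evalOn n S)
  rw [hS.surjective, finrank_top, Module.finrank_fintype_fun_eq_card, Fintype.card_coe] at h2
  have h3 := rank_add_finrank_ker n β
  have h4 := Submodule.eq_of_le_of_finrank_le (ker_le_ker_evalOn h) (by omega)
  have h5 : coeffVec n p ∈ LinearMap.ker (evalOn n S) := by
    rw [LinearMap.mem_ker]
    ext z
    rw [evalOn_apply, ofCoeffs_coeffVec hp]
    exact hz z.1 z.2
  rw [← h4, LinearMap.mem_ker, Matrix.mulVecLin_apply] at h5
  exact h5

end TruncMoment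

/-! ### Affine coordinates and the functional on the curve -/

namespace TruncMoment

open MvPolynomial

/-- Affine coordinates `u`, `v` on the plane. -/
structure AffineCoords (u v : MvPolynomial (Fin 2) ℝ) where
  u_mem : u ∈ polysLE 1
  v_mem : v ∈ polysLE 1
  X_mem : ∀ i : Fin 2, ∃ a b c : ℝ, (X i : MvPolynomial (Fin 2) ℝ) = C a + C b * u + C c * v
  pt : ℝ → ℝ → ℝ × ℝ
  eval_u : ∀ s t, evalAt (pt s t) u = s
  eval_v : ∀ s t, evalAt (pt s t) v = t
  pt_eval : ∀ z, pt (evalAt z u) (evalAt z v) = z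

/-- The coordinates in the opposite order. -/
def AffineCoords.swap {u v : MvPolynomial (Fin 2) ℝ} (A : AffineCoords u v) :
    AffineCoords v u where
  u_mem := A.v_mem
  v_mem := A.u_mem
  X_mem i := by
    obtain ⟨a, b, c, h⟩ := A.X_mem i
    exact ⟨a, c, b, by rw [h]; ring⟩
  pt s t := A.pt t s
  eval_u s t := A.eval_v t s
  eval_v s t := A.eval_u t s
  pt_eval := A.pt_eval

theorem C_mem_polysLE (c : ℝ) (n : ℕ) : (C c : MvPolynomial (Fin 2) ℝ) ∈ polysLE n := by
  rw [mem_polysLE, totalDegree_C]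
  exact Nat.zero_le n

theorem X_mem_polysLE (i : Fin 2) : (X i : MvPolynomial (Fin 2) ℝ) ∈ polysLE 1 := by
  rw [mem_polysLE, totalDegree_X]

theorem exists_affineCoords {a b c d p q : ℝ} (h : a * d - b * c ≠ 0) :
    Nonempty (AffineCoords (C a * X 0 + C b * X 1 + C p) (C c * X 0 + C d * X 1 + C q)) := by
  have hlin : ∀ a b c : ℝ, (C a * X 0 + C b * X 1 + C c : MvPolynomial (Fin 2) ℝ) ∈ polysLE 1 :=
    fun a b c => Submodule.add_mem _ (Submodule.add_mem _
      (by simpa using mul_mem_polysLE (C_mem_polysLE a 0) (X_mem_polysLE 0))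
      (by simpa using mul_mem_polysLE (C_mem_polysLE b 0) (X_mem_polysLE 1))) (C_mem_polysLE c 1)
  -- The determinant is kept opaque so that `field_simp` clears it as an atom; the inverse map is
  -- Cramer's rule.
  obtain ⟨D, hD⟩ : ∃ D, D = a * d - b * c := ⟨_, rfl⟩
  rw [← hD] at h
  refine ⟨⟨hlin _ _ _, hlin _ _ _, ?_, fun s t =>
    ((d * (s - p) - b * (t - q)) / D, (a * (t - q) - c * (s - p)) / D), ?_, ?_, ?_⟩⟩
  · intro i
    fin_cases i
    · refine ⟨(b * q - d * p) / D, d / D, -b / D, ?_⟩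
      apply MvPolynomial.funext
      intro x
      simp only [Fin.zero_eta, map_add, map_mul, eval_C, eval_X]
      field_simp
      rw [hD]
      ring
    · refine ⟨(c * p - a * q) / D, -c / D, a / D, ?_⟩
      apply MvPolynomial.funext
      intro x
      simp only [Fin.mk_one, map_add, map_mul, eval_C, eval_X]
      field_simp
      rw [hD]
      ring
  · intro s t
    simp
    field_simp
    rw [hD]
    ring
  · intro s t
    simp
    field_simp
    rw [hD]
    ring
  · intro z
    ext
    · simp
      field_simp
      rw [hD]
      ring
    · simp
      field_simp
      rw [hD]
      ring

/-- Positive discriminant splits the quadratic part into two independent real linear forms. Adding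
constants `p` and `q` to them absorbs the linear terms, which leaves only a constant. -/
theorem IsHyperbola.exists_coords {Q : MvPolynomial (Fin 2) ℝ} (hQ : IsHyperbola Q) :
    ∃ (u v : MvPolynomial (Fin 2) ℝ) (κ : ℝ), Nonempty (AffineCoords u v) ∧ Q = u * v - C κ := by
  obtain ⟨a, b, c, d, e, f, hD, rfl⟩ := hQ
  obtain ⟨a1, b1, a2, b2, hdet, ha, hb, hc⟩ : ∃ a1 b1 a2 b2 : ℝ, a1 * b2 - b1 * a2 ≠ 0 ∧
      a = a1 * a2 ∧ b = a1 * b2 + b1 * a2 ∧ c = b1 * b2 := by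
    by_cases ha : a = 0
    · refine ⟨0, 1, b, c, ?_, by simp [ha], by ring, by ring⟩
      rintro h
      have : b = 0 := by linarith
      rw [this, ha] at hD
      simp at hD
    · have hs := Real.sq_sqrt hD.le
      have hs0 := Real.sqrt_pos.2 hD
      set r := √(b ^ 2 - 4 * a * c)
      refine ⟨a, (b - r) / 2, 1, (b + r) / (2 * a), ?_, by ring, ?_, ?_⟩
      · have : a * ((b + r) / (2 * a)) - (b - r) / 2 * 1 = r := by field_simp; ring
        rw [this]
        exact hs0.ne'
      · field_simp
        ring
      · field_simp
        linarith
  obtain ⟨p, q, hd, he⟩ : ∃ p q : ℝ, d = a1 * q + a2 * p ∧ e = b1 * q + b2 * p := by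
    obtain ⟨D, hD⟩ : ∃ D, D = a1 * b2 - b1 * a2 := ⟨_, rfl⟩
    rw [← hD] at hdet
    refine ⟨(a1 * e - b1 * d) / D, (d * b2 - e * a2) / D, ?_, ?_⟩ <;>
    · field_simp
      rw [hD]
      ring
  refine ⟨_, _, p * q - f, exists_affineCoords (p := p) (q := q) hdet, ?_⟩
  apply MvPolynomial.funext
  intro x
  simp only [map_add, map_sub, map_mul, map_pow, eval_C, eval_X]
  rw [ha, hb, hc, hd, he]
  ring

/-- The multiples of `Q`. -/
noncomputable def multiples (Q : MvPolynomial (Fin 2) ℝ) :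
    Submodule ℝ (MvPolynomial (Fin 2) ℝ) :=
  (Ideal.span {Q}).restrictScalars ℝ

theorem mem_multiples {Q p : MvPolynomial (Fin 2) ℝ} : p ∈ multiples Q ↔ Q ∣ p := by
  rw [multiples, Submodule.restrictScalars_mem, Ideal.mem_span_singleton]

/-- The polynomials that agree modulo `Q` with a polynomial of degree at most `n`. -/
noncomputable def polysMod (Q : MvPolynomial (Fin 2) ℝ) (n : ℕ) :
    Submodule ℝ (MvPolynomial (Fin 2) ℝ) :=
  polysLE n ⊔ multiples Q

theorem mem_polysMod {Q p : MvPolynomial (Fin 2) ℝ} {n : ℕ} :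
    p ∈ polysMod Q n ↔ ∃ r ∈ polysLE n, Q ∣ p - r := by
  rw [polysMod, Submodule.mem_sup]
  constructor
  · rintro ⟨r, hr, s, hs, rfl⟩
    exact ⟨r, hr, by rw [add_sub_cancel_left]; exact mem_multiples.1 hs⟩
  · rintro ⟨r, hr, h⟩
    exact ⟨r, hr, p - r, mem_multiples.2 h, by ring⟩

theorem polysMod_congr {Q p q : MvPolynomial (Fin 2) ℝ} {n : ℕ} (h : Q ∣ p - q)
    (hq : q ∈ polysMod Q n) : p ∈ polysMod Q n := by
  have := Submodule.add_mem (polysMod Q n) hq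
    (Submodule.mem_sup_right (mem_multiples.2 h) : p - q ∈ polysMod Q n)
  rwa [add_sub_cancel] at this

theorem dvd_mul_sub_mul {Q p p' q q' : MvPolynomial (Fin 2) ℝ} (hp : Q ∣ p - p')
    (hq : Q ∣ q - q') : Q ∣ p * q - p' * q' := by
  have : p * q - p' * q' = (p - p') * q + p' * (q - q') := by ring
  rw [this]
  exact dvd_add (hp.mul_right _) (hq.mul_left _)

theorem evalAt_eq_of_dvd {Q p q : MvPolynomial (Fin 2) ℝ} (h : Q ∣ p - q) {z : ℝ × ℝ}
    (hz : evalAt z Q = 0) : evalAt z p = evalAt z q := by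
  obtain ⟨s, hs⟩ := h
  have := congrArg (evalAt z) hs
  rw [map_sub, map_mul, hz, zero_mul, sub_eq_zero] at this
  exact this

/-- A functional on a subspace extends to a functional that vanishes on another subspace, if it
vanishes on the intersection. -/
theorem exists_functional_eq_on {V : Type*} [AddCommGroup V] [Module ℝ V] (l : V →ₗ[ℝ] ℝ)
    (M N : Submodule ℝ V) (h : ∀ x ∈ M, x ∈ N → l x = 0) :
    ∃ l' : V →ₗ[ℝ] ℝ, (∀ x ∈ M, l' x = l x) ∧ ∀ x ∈ N, l' x = 0 := by
  have h1 : l.comp M.subtype ∈ (LinearMap.ker (N.mkQ.comp M.subtype)).dualAnnihilator := by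
    rw [Submodule.mem_dualAnnihilator]
    intro x hx
    rw [LinearMap.mem_ker, LinearMap.comp_apply, Submodule.mkQ_apply,
      Submodule.Quotient.mk_eq_zero] at hx
    exact h _ x.2 hx
  rw [← LinearMap.range_dualMap_eq_dualAnnihilator_ker] at h1
  obtain ⟨ψ, hψ⟩ := h1
  refine ⟨ψ.comp N.mkQ, fun x hx => ?_, fun x hx => ?_⟩
  · exact DFunLike.congr_fun hψ ⟨x, hx⟩
  · rw [LinearMap.comp_apply, Submodule.mkQ_apply, (Submodule.Quotient.mk_eq_zero N).2 hx, map_zero]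

section Hyperbola

variable {u v Q : MvPolynomial (Fin 2) ℝ} {κ : ℝ} {n : ℕ} {β : ℕ → ℕ → ℝ}

theorem AffineCoords.mem_polysLE_two (A : AffineCoords u v) (hQ : Q = u * v - C κ) :
    Q ∈ polysLE 2 := by
  rw [hQ]
  exact Submodule.sub_mem _ (mul_mem_polysLE A.u_mem A.v_mem) (C_mem_polysLE κ 2)

/-- The mixed second difference over the unit square in the coordinates kills affine functions but
equals `1` on `u * v - C κ`. -/
theorem AffineCoords.notMem_polysLE_one (A : AffineCoords u v) (hQ : Q = u * v - C κ) :
    Q ∉ polysLE 1 := by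
  let e : ℝ → ℝ → MvPolynomial (Fin 2) ℝ →ₗ[ℝ] ℝ := fun s t =>
    (aeval ![(A.pt s t).1, (A.pt s t).2] : _ →ₐ[ℝ] ℝ).toLinearMap
  have he : ∀ s t p, e s t p = evalAt (A.pt s t) p := fun s t p => rfl
  have hX : ∀ i, (e 0 0 + e 1 1 - e 1 0 - e 0 1) (X i) = 0 := by
    intro i
    obtain ⟨a, b, c, h⟩ := A.X_mem i
    simp only [LinearMap.sub_apply, LinearMap.add_apply, he, h, map_add, map_mul, A.eval_u,
      A.eval_v, eval_C]
    ring
  have hle : polysLE 1 ≤ LinearMap.ker (e 0 0 + e 1 1 - e 1 0 - e 0 1) := by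
    refine polysLE_le fun m hm => ?_
    rw [LinearMap.mem_ker]
    have h3 : m = 0 ∨ m = Finsupp.single 0 1 ∨ m = Finsupp.single 1 1 := by
      rcases Nat.eq_zero_or_pos (m 0) with h0 | h0
      · rcases Nat.eq_zero_or_pos (m 1) with h1 | h1
        · left
          ext i; fin_cases i <;> simp [h0, h1]
        · right; right
          have : m 1 = 1 := by omega
          ext i; fin_cases i <;> simp [h0, this]
      · right; left
        have h1 : m 0 = 1 := by omega
        have h2 : m 1 = 0 := by omega
        ext i; fin_cases i <;> simp [h1, h2]
    rcases h3 with rfl | rfl | rfl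
    · simp [he]
    · exact hX 0
    · exact hX 1
  intro h
  have := hle h
  rw [LinearMap.mem_ker] at this
  simp only [LinearMap.sub_apply, LinearMap.add_apply, he, hQ, map_sub, map_mul, A.eval_u,
      A.eval_v, eval_C] at this
  norm_num at this

theorem AffineCoords.totalDegree_eq (A : AffineCoords u v) (hQ : Q = u * v - C κ) :
    Q.totalDegree = 2 := by
  have h1 := mem_polysLE.1 (A.mem_polysLE_two hQ)
  have h2 := mt mem_polysLE.2 (A.notMem_polysLE_one hQ)
  omega

/-- The column relation `Q(X, Y) = 0` and its recursive consequences: the Riesz functional vanishes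
on the multiples of `Q`. -/
theorem riesz_mul_eq_zero (hQ2 : Q.totalDegree = 2) (hn : 2 ≤ n) (hrec : RecursivelyGenerated n β)
    (hcol : column n β Q = 0) {s : MvPolynomial (Fin 2) ℝ} (hs : s ∈ polysLE (2 * n - 2)) :
    riesz β (Q * s) = 0 := by
  have : polysLE (2 * n - 2) ≤ LinearMap.ker ((riesz β).comp (LinearMap.mulLeft ℝ Q)) := by
    refine polysLE_le fun m hm => ?_
    -- A monomial of degree at most `2 * n - 2` is split into degrees at most `n - 2` and `n`: the
    -- first factor times `Q` is a column relation by recursiveness, and the second tests it.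
    obtain ⟨i, j, hi, hj, hij, hij'⟩ : ∃ i j, i ≤ m 0 ∧ j ≤ m 1 ∧ i + j ≤ n - 2 ∧
        (m 0 - i) + (m 1 - j) ≤ n :=
      ⟨min (m 0) (n - 2), min (m 1) (n - 2 - min (m 0) (n - 2)), by omega, by omega, by omega,
        by omega⟩
    have e : monomial m (1 : ℝ) =
        monomial (expo (j, i)) 1 * monomial (expo (m 1 - j, m 0 - i)) 1 := by
      have hm : m = expo (j, i) + expo (m 1 - j, m 0 - i) := by
        ext k
        fin_cases k
        · simp; omega
        · simp; omega
      rw [monomial_mul, mul_one, ← hm]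
    have h1 : (monomial (expo (j, i)) (1 : ℝ)) ∈ polysLE (n - 2) :=
      monomial_mem_polysLE (by rw [expo_zero, expo_one]; exact hij)
    have h2 : (monomial (expo (m 1 - j, m 0 - i)) (1 : ℝ)) ∈ polysLE n :=
      monomial_mem_polysLE (by rw [expo_zero, expo_one]; exact hij')
    have h3 : Q * monomial (expo (j, i)) (1 : ℝ) ∈ polysLE n := by
      have := mul_mem_polysLE (mem_polysLE.2 hQ2.le) h1
      rwa [show 2 + (n - 2) = n by omega] at this
    have h4 := hrec Q (monomial (expo (j, i)) 1) (by omega)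
      (mem_polysLE.1 (polysLE_mono (by omega) h1)) (mem_polysLE.1 h3) hcol
    rw [LinearMap.mem_ker, LinearMap.comp_apply, LinearMap.mulLeft_apply, e, ← mul_assoc]
    exact (column_eq_zero_iff h3).1 h4 _ h2
  exact this hs

/-- The functional on the coordinate ring of the curve `Q = 0` that the moments define. -/
theorem exists_riesz_mod (hQ2 : Q.totalDegree = 2) (hn : 2 ≤ n)
    (hrec : RecursivelyGenerated n β) (hcol : column n β Q = 0) :
    ∃ l : MvPolynomial (Fin 2) ℝ →ₗ[ℝ] ℝ, (∀ p ∈ polysLE (2 * n), l p = riesz β p) ∧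
      ∀ p ∈ multiples Q, l p = 0 := by
  refine exists_functional_eq_on _ _ _ fun p hp hpQ => ?_
  obtain ⟨s, rfl⟩ := mem_multiples.1 hpQ
  rcases eq_or_ne s 0 with rfl | hs
  · simp
  have hQ0 : Q ≠ 0 := by rintro rfl; simp at hQ2
  refine riesz_mul_eq_zero hQ2 hn hrec hcol ?_
  rw [mem_polysLE, totalDegree_mul_of_isDomain hQ0 hs] at hp
  rw [mem_polysLE]
  omega

/-- The functional `l` on the coordinate ring of the curve `Q = 0` represents the moments `β` in
degree `2 * n`. -/
structure IsRieszMod (Q : MvPolynomial (Fin 2) ℝ) (n : ℕ) (β : ℕ → ℕ → ℝ)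
    (l : MvPolynomial (Fin 2) ℝ →ₗ[ℝ] ℝ) : Prop where
  eq_riesz : ∀ p ∈ polysLE (2 * n), l p = riesz β p
  map_multiple : ∀ p ∈ multiples Q, l p = 0

variable {l : MvPolynomial (Fin 2) ℝ →ₗ[ℝ] ℝ}

theorem IsRieszMod.congr (hl : IsRieszMod Q n β l) {p q : MvPolynomial (Fin 2) ℝ}
    (h : Q ∣ p - q) : l p = l q := by
  rw [← sub_eq_zero, ← map_sub]
  exact hl.map_multiple _ (mem_multiples.2 h)

theorem IsRieszMod.mul_self (hl : IsRieszMod Q n β l) {p r : MvPolynomial (Fin 2) ℝ}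
    (hr : r ∈ polysLE n) (h : Q ∣ p - r) : l (p * p) = riesz β (r * r) := by
  rw [hl.congr (dvd_mul_sub_mul h h), hl.eq_riesz]
  rw [two_mul]
  exact mul_mem_polysLE hr hr

theorem IsRieszMod.nonneg (hl : IsRieszMod Q n β l) (hpos : (momentMatrix n β).PosSemidef)
    {p : MvPolynomial (Fin 2) ℝ} (hp : p ∈ polysMod Q n) : 0 ≤ l (p * p) := by
  obtain ⟨r, hr, h⟩ := mem_polysMod.1 hp
  rw [hl.mul_self hr h]
  exact posSemidef_iff.1 hpos r hr

/-- The null space of the form `l (p * p)` on the functions of degree at most `n` on the curve is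
stable under multiplication by `u` and `v`, as far as the degree allows. -/
def StronglyRecursive (u v Q : MvPolynomial (Fin 2) ℝ) (n : ℕ)
    (l : MvPolynomial (Fin 2) ℝ →ₗ[ℝ] ℝ) : Prop :=
  ∀ p ∈ polysMod Q n, l (p * p) = 0 → ∀ q, q = u ∨ q = v → q * p ∈ polysMod Q n →
    l ((q * p) * (q * p)) = 0

theorem riesz_eq_of_extends {β' : ℕ → ℕ → ℝ} (h : Extends n β β')
    {p : MvPolynomial (Fin 2) ℝ} (hp : p ∈ polysLE (2 * n)) : riesz β' p = riesz β p := by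
  have : polysLE (2 * n) ≤ LinearMap.ker (riesz β' - riesz β) := by
    refine polysLE_le fun m hm => ?_
    rw [LinearMap.mem_ker, LinearMap.sub_apply, riesz_monomial, riesz_monomial,
      h _ _ (by omega), sub_self]
  have := this hp
  rwa [LinearMap.mem_ker, LinearMap.sub_apply, sub_eq_zero] at this

theorem riesz_mul_eq_of_extends {β' : ℕ → ℕ → ℝ} (h : Extends n β β')
    {p q : MvPolynomial (Fin 2) ℝ} (hp : p ∈ polysLE n) (hq : q ∈ polysLE n) :
    riesz β' (p * q) = riesz β (p * q) := by
  refine riesz_eq_of_extends h ?_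
  rw [two_mul]
  exact mul_mem_polysLE hp hq

/-- A null `p` lifts to a column relation of `M(n + 1)`, where `q * p` fits even before reduction
modulo `Q`. The multiple of `Q` removed by the reduction is also a relation there, hence so is the
reduced polynomial. -/
theorem stronglyRecursive_of_extension (A : AffineCoords u v) (hQ2 : Q.totalDegree = 2)
    (hn : 2 ≤ n) (hpos : (momentMatrix n β).PosSemidef) (hcol : column n β Q = 0)
    (hl : IsRieszMod Q n β l) {β' : ℕ → ℕ → ℝ} (h : PosRecExtends n β β') :
    StronglyRecursive u v Q n l := by
  obtain ⟨hext, hpos', hrec'⟩ := h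
  have hlift : ∀ p ∈ polysLE n, riesz β (p * p) = 0 → column (n + 1) β' p = 0 := by
    intro p hp h0
    rw [column_eq_zero_iff_sq hpos' (polysLE_mono (Nat.le_succ n) hp),
      riesz_mul_eq_of_extends hext hp hp, h0]
  have hQn : Q ∈ polysLE n := mem_polysLE.2 (by omega)
  have hQ0 : Q ≠ 0 := by rintro rfl; simp at hQ2
  intro p hp h0 q hq hqp
  have hq1 : q ∈ polysLE 1 := by
    rcases hq with rfl | rfl
    exacts [A.u_mem, A.v_mem]
  obtain ⟨p', hp', hpp'⟩ := mem_polysMod.1 hp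
  obtain ⟨r, hr, hqr⟩ := mem_polysMod.1 hqp
  rw [hl.mul_self hp' hpp'] at h0
  rw [hl.mul_self hr hqr, ← riesz_mul_eq_of_extends hext hr hr]
  have hr' := polysLE_mono (Nat.le_succ n) hr
  have hqp' : q * p' ∈ polysLE (n + 1) := by
    rw [add_comm]
    exact mul_mem_polysLE hq1 hp'
  have h1 := hrec' p' q (mem_polysLE.1 (polysLE_mono (Nat.le_succ n) hp'))
    (mem_polysLE.1 (polysLE_mono (by omega) hq1)) (by rw [mul_comm]; exact mem_polysLE.1 hqp')
    (hlift p' hp' h0)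
  rw [mul_comm] at h1
  obtain ⟨s, hs⟩ : Q ∣ q * p' - r := by
    have e : q * p' - r = (q * p - r) - q * (p - p') := by ring
    rw [e]
    exact dvd_sub hqr (hpp'.mul_left _)
  have hQs : Q * s ∈ polysLE (n + 1) := by
    rw [← hs]
    exact Submodule.sub_mem _ hqp' hr'
  have h2 : column (n + 1) β' (Q * s) = 0 := by
    rcases eq_or_ne s 0 with rfl | hs0
    · rw [mul_zero, column_eq_zero_iff (Submodule.zero_mem _)]
      simp
    refine hrec' Q s (by omega) ?_ (mem_polysLE.1 hQs)
      (hlift Q hQn ((column_eq_zero_iff_sq hpos hQn).1 hcol))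
    rw [mem_polysLE, totalDegree_mul_of_isDomain hQ0 hs0] at hQs
    omega
  have e : r * r = (q * p') * r - (Q * s) * r := by rw [← hs]; ring
  rw [e, map_sub, (column_eq_zero_iff hqp').1 h1 r hr', (column_eq_zero_iff hQs).1 h2 r hr',
    sub_zero]

end Hyperbola

end TruncMoment

/-! ### Normal forms modulo `Q` and atomic representations -/

namespace TruncMoment

open MvPolynomial
open scoped Polynomial

theorem evalAt_aeval (z : ℝ × ℝ) (u : MvPolynomial (Fin 2) ℝ) (a : ℝ[X]) :
    evalAt z (Polynomial.aeval u a) = a.eval (evalAt z u) := by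
  rw [Polynomial.aeval_def, Polynomial.hom_eval₂, Polynomial.eval]
  congr 1
  ext x
  simp

theorem aeval_mem_polysLE {u : MvPolynomial (Fin 2) ℝ} (hu : u ∈ polysLE 1) {a : ℝ[X]} {k : ℕ}
    (ha : a.natDegree ≤ k) : Polynomial.aeval u a ∈ polysLE k := by
  have hpow : ∀ j, u ^ j ∈ polysLE j := by
    intro j
    induction j with
    | zero => simp [mem_polysLE]
    | succ j ih => rw [pow_succ]; exact mul_mem_polysLE ih hu
  rw [Polynomial.aeval_eq_sum_range]
  refine Submodule.sum_mem _ fun j hj => Submodule.smul_mem _ _ (polysLE_mono ?_ (hpow j))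
  rw [Finset.mem_range] at hj
  omega

theorem polysLE_le_polysMod (Q : MvPolynomial (Fin 2) ℝ) (k : ℕ) : polysLE k ≤ polysMod Q k :=
  le_sup_left

/-- The polynomials of degree at most `k` in `u`. -/
noncomputable def axisPolys (u : MvPolynomial (Fin 2) ℝ) (k : ℕ) :
    Submodule ℝ (MvPolynomial (Fin 2) ℝ) :=
  (Polynomial.degreeLT ℝ (k + 1)).map (Polynomial.aeval u).toLinearMap

theorem mem_axisPolys {u p : MvPolynomial (Fin 2) ℝ} {k : ℕ} :
    p ∈ axisPolys u k ↔ ∃ a : ℝ[X], a.natDegree ≤ k ∧ Polynomial.aeval u a = p := by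
  simp [axisPolys, Submodule.mem_map, mem_degreeLT_succ]

theorem axisPolys_mono {u : MvPolynomial (Fin 2) ℝ} {k m : ℕ} (h : k ≤ m) :
    axisPolys u k ≤ axisPolys u m := fun p hp => by
  obtain ⟨a, ha, rfl⟩ := mem_axisPolys.1 hp
  exact mem_axisPolys.2 ⟨a, ha.trans h, rfl⟩

/-- The polynomials that agree modulo `Q` with a sum of a polynomial in `u` and a polynomial in `v`,
both of degree at most `k`. -/
noncomputable def sumPolys (u v Q : MvPolynomial (Fin 2) ℝ) (k : ℕ) :
    Submodule ℝ (MvPolynomial (Fin 2) ℝ) :=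
  axisPolys u k ⊔ axisPolys v k ⊔ multiples Q

theorem sumPolys_comm (u v Q : MvPolynomial (Fin 2) ℝ) (k : ℕ) :
    sumPolys u v Q k = sumPolys v u Q k := by
  rw [sumPolys, sup_comm (axisPolys u k), sumPolys]

theorem mem_sumPolys {u v Q p : MvPolynomial (Fin 2) ℝ} {k : ℕ} :
    p ∈ sumPolys u v Q k ↔ ∃ a b : ℝ[X], a.natDegree ≤ k ∧ b.natDegree ≤ k ∧
      Q ∣ p - (Polynomial.aeval u a + Polynomial.aeval v b) := by
  simp only [sumPolys, Submodule.mem_sup, mem_axisPolys, mem_multiples]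
  constructor
  · rintro ⟨_, ⟨_, ⟨a, ha, rfl⟩, _, ⟨b, hb, rfl⟩, rfl⟩, s, hs, rfl⟩
    exact ⟨a, b, ha, hb, by rwa [add_sub_cancel_left]⟩
  · rintro ⟨a, b, ha, hb, h⟩
    exact ⟨_, ⟨_, ⟨a, ha, rfl⟩, _, ⟨b, hb, rfl⟩, rfl⟩, _, h, by ring⟩

theorem sumPolys_mono {u v Q : MvPolynomial (Fin 2) ℝ} {k m : ℕ} (h : k ≤ m) :
    sumPolys u v Q k ≤ sumPolys u v Q m :=
  sup_le_sup_right (sup_le_sup (axisPolys_mono h) (axisPolys_mono h)) _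

section Hyperbola

variable {u v Q : MvPolynomial (Fin 2) ℝ} {κ : ℝ} {n : ℕ} {β : ℕ → ℕ → ℝ}
  {l : MvPolynomial (Fin 2) ℝ →ₗ[ℝ] ℝ}

/-- Since `u * v = κ` on the curve, `u * b(v)` reduces to `b(0) * u` plus `κ` times `b.divX`
evaluated at `v`. -/
theorem u_mul_mem_sumPolys (hQ : Q = u * v - C κ) {p : MvPolynomial (Fin 2) ℝ} {k : ℕ}
    (hp : p ∈ sumPolys u v Q k) : u * p ∈ sumPolys u v Q (k + 1) := by
  obtain ⟨a, b, ha, hb, s, hs⟩ := mem_sumPolys.1 hp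
  refine mem_sumPolys.2 ⟨Polynomial.X * a + Polynomial.C (b.coeff 0) * Polynomial.X,
    Polynomial.C κ * b.divX, ?_, ?_, Polynomial.aeval v b.divX + u * s, ?_⟩
  · refine (Polynomial.natDegree_add_le _ _).trans (max_le (natDegree_X_mul_le ha) ?_)
    exact (Polynomial.natDegree_C_mul_le _ _).trans (by rw [Polynomial.natDegree_X]; omega)
  · refine (Polynomial.natDegree_C_mul_le _ _).trans ?_
    rw [Polynomial.natDegree_divX_eq_natDegree_tsub_one]
    omega
  · have hb' : Polynomial.aeval v b = Polynomial.aeval v b.divX * v + C (b.coeff 0) := by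
      conv_lhs => rw [← b.divX_mul_X_add]
      simp [MvPolynomial.algebraMap_eq]
    rw [hb', sub_eq_iff_eq_add] at hs
    rw [hs]
    simp only [map_add, map_mul, Polynomial.aeval_X, Polynomial.aeval_C,
      MvPolynomial.algebraMap_eq]
    rw [hQ]
    ring

theorem v_mul_mem_sumPolys (hQ : Q = u * v - C κ) {p : MvPolynomial (Fin 2) ℝ} {k : ℕ}
    (hp : p ∈ sumPolys u v Q k) : v * p ∈ sumPolys u v Q (k + 1) := by
  rw [sumPolys_comm] at hp ⊢
  exact u_mul_mem_sumPolys (by rw [hQ, mul_comm]) hp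

theorem AffineCoords.polysLE_le_sumPolys (A : AffineCoords u v) (hQ : Q = u * v - C κ) (k : ℕ) :
    polysLE k ≤ sumPolys u v Q k := by
  have hX : ∀ (i : Fin 2) (j : ℕ) (p : MvPolynomial (Fin 2) ℝ), p ∈ sumPolys u v Q j →
      X i * p ∈ sumPolys u v Q (j + 1) := by
    intro i j p hp
    obtain ⟨a, b, c, h⟩ := A.X_mem i
    have e : X i * p = a • p + b • (u * p) + c • (v * p) := by
      rw [h]
      simp only [smul_eq_C_mul]
      ring
    rw [e]
    exact Submodule.add_mem _ (Submodule.add_mem _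
      (Submodule.smul_mem _ _ (sumPolys_mono (Nat.le_succ j) hp))
      (Submodule.smul_mem _ _ (u_mul_mem_sumPolys hQ hp)))
      (Submodule.smul_mem _ _ (v_mul_mem_sumPolys hQ hp))
  have hone : (1 : MvPolynomial (Fin 2) ℝ) ∈ sumPolys u v Q 0 :=
    mem_sumPolys.2 ⟨1, 0, by simp, by simp, by simp⟩
  have hmon : ∀ i j, (X 0 ^ i * (X 1 ^ j * 1) : MvPolynomial (Fin 2) ℝ) ∈
      sumPolys u v Q (i + j) := by
    intro i j
    induction i with
    | zero =>
      induction j with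
      | zero => simpa using hone
      | succ j ih =>
        have := hX 1 _ _ ih
        rw [pow_succ']
        rw [pow_zero, one_mul, mul_one] at this ⊢
        exact this
    | succ i ih =>
      have := hX 0 _ _ ih
      rw [← mul_assoc, ← pow_succ'] at this
      rwa [show i + 1 + j = i + j + 1 by omega]
  refine polysLE_le fun m hm => sumPolys_mono hm ?_
  have h1 : monomial m (1 : ℝ) = X 0 ^ m 0 * (X 1 ^ m 1 * 1) := by
    rw [monomial_eq, Finsupp.prod_fintype _ _ (fun i => pow_zero _), Fin.prod_univ_two]
    simp
  rw [h1]
  exact hmon _ _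

theorem mem_variety_iff {z : ℝ × ℝ} :
    z ∈ variety n β ↔ ∀ p ∈ polysLE n, column n β p = 0 → evalAt z p = 0 :=
  ⟨fun h p hp h0 => h p (mem_polysLE.1 hp) h0, fun h p hp h0 => h p (mem_polysLE.2 hp) h0⟩

/-- The moments of degree at most `2 * n` are those of a finite atomic measure. The last condition
relates the number of atoms to the rank of `M(n)`. -/
def HasAtoms (n : ℕ) (β : ℕ → ℕ → ℝ) : Prop :=
  ∃ (S : Finset (ℝ × ℝ)) (c : ℝ × ℝ → ℝ), (∀ z ∈ S, 0 < c z) ∧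
    (∀ p ∈ polysLE (2 * n), riesz β p = ∑ z ∈ S, c z * evalAt z p) ∧ Separates (n + 1) S ∧
    (Separates n S ∨ ∃ z ∈ S, Separates n (S.erase z) ∧ 2 * n + 2 ≤ S.card)

theorem IsRieszMod.column_eq_zero_iff (hl : IsRieszMod Q n β l)
    (hpos : (momentMatrix n β).PosSemidef) {p r : MvPolynomial (Fin 2) ℝ} (hr : r ∈ polysLE n)
    (h : Q ∣ p - r) : column n β r = 0 ↔ l (p * p) = 0 := by
  rw [column_eq_zero_iff_sq hpos hr, hl.mul_self hr h]

theorem IsRieszMod.column_eq_zero_of_dvd (hl : IsRieszMod Q n β l)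
    (hpos : (momentMatrix n β).PosSemidef) {p : MvPolynomial (Fin 2) ℝ} (hp : p ∈ polysLE n)
    (h : Q ∣ p) : column n β p = 0 := by
  rw [hl.column_eq_zero_iff hpos hp (p := 0) (by rw [zero_sub]; exact h.neg_right)]
  simp

/-- By the dimension count a polynomial is null exactly when it vanishes on `S`, and vanishing on
`S` survives any multiplication. -/
theorem stronglyRecursive_of_separates (hl : IsRieszMod Q n β l)
    (hpos : (momentMatrix n β).PosSemidef) {S : Finset (ℝ × ℝ)}
    (hSQ : ∀ z ∈ S, evalAt z Q = 0) (hSV : ∀ z ∈ S, z ∈ variety n β) (hS : Separates n S)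
    (hr : (momentMatrix n β).rank ≤ S.card) : StronglyRecursive u v Q n l := by
  intro p hp h0 q _ hqp
  obtain ⟨p', hp', hpp'⟩ := mem_polysMod.1 hp
  obtain ⟨r, hr', hqr⟩ := mem_polysMod.1 hqp
  rw [← hl.column_eq_zero_iff hpos hr' hqr]
  refine column_eq_zero_of_rank_le hS (fun p hp h0 z hz => mem_variety_iff.1 (hSV z hz) p hp h0)
    hr hr' fun z hz => ?_
  have h1 := mem_variety_iff.1 (hSV z hz) p' hp' ((hl.column_eq_zero_iff hpos hp' hpp').2 h0)
  rw [← evalAt_eq_of_dvd hqr (hSQ z hz), map_mul, evalAt_eq_of_dvd hpp' (hSQ z hz), h1, mul_zero]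

end Hyperbola

end TruncMoment

/-! ### The nondegenerate hyperbola -/

namespace TruncMoment

open MvPolynomial
open scoped Polynomial

section Nondegenerate

variable {u v w Q : MvPolynomial (Fin 2) ℝ} {κ : ℝ} {n : ℕ} {β : ℕ → ℕ → ℝ}
  {l : MvPolynomial (Fin 2) ℝ →ₗ[ℝ] ℝ}

theorem dvd_pow_mul_pow_sub_one (hw : Q ∣ w * u - 1) (k : ℕ) : Q ∣ w ^ k * u ^ k - 1 := by
  rw [← mul_pow]
  exact hw.trans (by simpa using sub_dvd_pow_sub_pow (w * u) 1 k)

/-- If `w` is the inverse of `u` on the curve, then `w ^ k * f(u)` has degree at most `k` on the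
curve for all polynomials `f` of degree at most `2 * k`. -/
theorem pow_mul_aeval_mem_polysMod (hu1 : u ∈ polysLE 1) (hw1 : w ∈ polysLE 1)
    (hw : Q ∣ w * u - 1) {k : ℕ} {f : ℝ[X]} (hf : f.natDegree ≤ 2 * k) :
    w ^ k * Polynomial.aeval u f ∈ polysMod Q k := by
  have hpow : ∀ (x : MvPolynomial (Fin 2) ℝ) (_ : x ∈ polysLE 1) (j : ℕ), x ^ j ∈ polysLE j :=
    fun x hx j => by
      have := aeval_mem_polysLE hx (Polynomial.natDegree_X_pow_le (R := ℝ) j)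
      simpa using this
  rw [Polynomial.aeval_eq_sum_range, Finset.mul_sum]
  refine Submodule.sum_mem _ fun j hj => ?_
  rw [Finset.mem_range] at hj
  rw [mul_smul_comm]
  refine Submodule.smul_mem _ _ ?_
  rcases le_total j k with hjk | hjk
  · refine polysMod_congr (q := w ^ (k - j)) ?_
      (polysLE_le_polysMod Q k (polysLE_mono (by omega) (hpow w hw1 _)))
    obtain ⟨i, rfl⟩ := Nat.exists_eq_add_of_le hjk
    have e : w ^ (j + i) * u ^ j - w ^ (j + i - j) = w ^ i * (w ^ j * u ^ j - 1) := by
      rw [Nat.add_sub_cancel_left]; ring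
    rw [e]
    exact (dvd_pow_mul_pow_sub_one hw j).mul_left _
  · refine polysMod_congr (q := u ^ (j - k)) ?_
      (polysLE_le_polysMod Q k (polysLE_mono (by omega) (hpow u hu1 _)))
    obtain ⟨i, rfl⟩ := Nat.exists_eq_add_of_le hjk
    have e : w ^ k * u ^ (k + i) - u ^ (k + i - k) = u ^ i * (w ^ k * u ^ k - 1) := by
      rw [Nat.add_sub_cancel_left]; ring
    rw [e]
    exact (dvd_pow_mul_pow_sub_one hw k).mul_left _

/-- On the curve, all polynomials of degree at most `k` are of the form `w ^ k * f(u)`. -/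
theorem exists_pow_mul_aeval (A : AffineCoords u v) (hQ : Q = u * v - C κ) (hv : v = C κ * w)
    (hw : Q ∣ w * u - 1) {k : ℕ} {p : MvPolynomial (Fin 2) ℝ} (hp : p ∈ polysLE k) :
    ∃ f : ℝ[X], f.natDegree ≤ 2 * k ∧ Q ∣ p - w ^ k * Polynomial.aeval u f := by
  let M : Submodule ℝ (MvPolynomial (Fin 2) ℝ) :=
    ((axisPolys u (2 * k)).map (LinearMap.mulLeft ℝ (w ^ k))) ⊔ multiples Q
  have hM : ∀ p, p ∈ M ↔ ∃ f : ℝ[X], f.natDegree ≤ 2 * k ∧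
      Q ∣ p - w ^ k * Polynomial.aeval u f := by
    intro p
    simp only [M, Submodule.mem_sup, Submodule.mem_map, mem_axisPolys, mem_multiples,
      LinearMap.mulLeft_apply]
    constructor
    · rintro ⟨_, ⟨_, ⟨f, hf, rfl⟩, rfl⟩, s, hs, rfl⟩
      exact ⟨f, hf, by rwa [add_sub_cancel_left]⟩
    · rintro ⟨f, hf, h⟩
      exact ⟨_, ⟨_, ⟨f, hf, rfl⟩, rfl⟩, _, h, by ring⟩
  obtain ⟨a, b, ha, hb, h⟩ := mem_sumPolys.1 (A.polysLE_le_sumPolys hQ k hp)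
  rw [← hM]
  have h1 : Polynomial.aeval u a ∈ M := by
    rw [hM]
    refine ⟨Polynomial.X ^ k * a, Polynomial.natDegree_mul_le.trans ?_, ?_⟩
    · rw [Polynomial.natDegree_X_pow]; omega
    · have e : Polynomial.aeval u a - w ^ k * Polynomial.aeval u (Polynomial.X ^ k * a) =
          -((w ^ k * u ^ k - 1) * Polynomial.aeval u a) := by
        simp only [map_mul, map_pow, Polynomial.aeval_X]
        ring
      rw [e]
      exact ((dvd_pow_mul_pow_sub_one hw k).mul_right _).neg_right
  have h2 : Polynomial.aeval v b ∈ M := by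
    rw [Polynomial.aeval_eq_sum_range]
    refine Submodule.sum_mem _ fun j hj => Submodule.smul_mem _ _ ?_
    rw [Finset.mem_range] at hj
    obtain ⟨i, rfl⟩ := Nat.exists_eq_add_of_le (show j ≤ k by omega)
    rw [hM]
    refine ⟨Polynomial.C (κ ^ j) * Polynomial.X ^ i,
      (Polynomial.natDegree_C_mul_X_pow_le _ _).trans (by omega), ?_⟩
    have e : v ^ j - w ^ (j + i) * Polynomial.aeval u (Polynomial.C (κ ^ j) * Polynomial.X ^ i) =
        -(C (κ ^ j) * w ^ j * (w ^ i * u ^ i - 1)) := by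
      simp only [map_mul, map_pow, Polynomial.aeval_X, Polynomial.aeval_C,
        MvPolynomial.algebraMap_eq]
      rw [hv]
      ring
    rw [e]
    exact ((dvd_pow_mul_pow_sub_one hw i).mul_left _).neg_right
  have := M.add_mem (M.add_mem h1 h2) (Submodule.mem_sup_right (mem_multiples.2 h))
  rwa [add_sub_cancel] at this

/-- A point of the curve is determined by its `u`-coordinate `s ≠ 0`. One-variable interpolation of
`s ^ n * φ`, times `w ^ n`, takes the values `φ` and has degree at most `n` on the curve. -/
theorem separates_of_card_le (A : AffineCoords u v) (hQ : Q = u * v - C κ)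
    (hκ : κ ≠ 0) (hw1 : w ∈ polysLE 1) (hw : Q ∣ w * u - 1)
    {S : Finset (ℝ × ℝ)} (hS : ∀ z ∈ S, evalAt z Q = 0) (hcard : S.card ≤ 2 * n + 1) :
    Separates n S := by
  classical
  intro φ
  set T := S.image fun z => evalAt z u
  have hT : T.card ≤ 2 * n + 1 := Finset.card_image_le.trans hcard
  have hinj : Set.InjOn (id : ℝ → ℝ) (T : Set ℝ) := Function.injective_id.injOn
  set f := Lagrange.interpolate T id fun s => s ^ n * φ (A.pt s (κ / s)) with hf
  have hfd : f.natDegree ≤ 2 * n := by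
    rw [← mem_degreeLT_succ, Polynomial.mem_degreeLT]
    exact (Lagrange.degree_interpolate_lt _ hinj).trans_le (by exact_mod_cast hT)
  obtain ⟨r, hr, h⟩ := mem_polysMod.1 (pow_mul_aeval_mem_polysMod A.u_mem hw1 hw hfd)
  refine ⟨r, hr, fun z hz => ?_⟩
  have hz0 := hS z hz
  rw [← evalAt_eq_of_dvd h hz0, map_mul, map_pow, evalAt_aeval]
  have huv : evalAt z u * evalAt z v = κ := by
    rw [hQ, map_sub, map_mul, eval_C, sub_eq_zero] at hz0
    exact hz0
  have hu0 : evalAt z u ≠ 0 := by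
    intro h0
    rw [h0, zero_mul] at huv
    exact hκ huv.symm
  have hwz : evalAt z w * evalAt z u = 1 := by
    obtain ⟨s, hs⟩ := hw
    have := congrArg (evalAt z) hs
    rw [map_mul, hz0, zero_mul, map_sub, map_mul, map_one, sub_eq_zero] at this
    exact this
  have h1 : f.eval (evalAt z u) = _ :=
    Lagrange.eval_interpolate_at_node (v := id) _ hinj (Finset.mem_image_of_mem _ hz)
  rw [h1, ← mul_assoc, ← mul_pow, hwz, one_pow, one_mul,
    show κ / evalAt z u = evalAt z v by rw [← huv]; field_simp, A.pt_eval]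

/-- On the curve a polynomial of degree at most `n` is `w ^ n * f(u)` with `f` of degree at most `2
* n`, so `2 * n + 1` points of the curve determine it. -/
theorem rank_le_of_nondegenerate (A : AffineCoords u v) (hQ : Q = u * v - C κ)
    (hκ : κ ≠ 0) (hv : v = C κ * w) (hw : Q ∣ w * u - 1)
    (hpos : (momentMatrix n β).PosSemidef) (hl : IsRieszMod Q n β l) :
    (momentMatrix n β).rank ≤ 2 * n + 1 := by
  classical
  let T : Finset ℝ := (Finset.range (2 * n + 1)).image fun j : ℕ => (j : ℝ) + 1
  have hT : T.card = 2 * n + 1 := by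
    rw [Finset.card_image_of_injective, Finset.card_range]
    intro i j hij
    have : (i : ℝ) = j := by simpa using hij
    exact_mod_cast this
  refine (rank_le_card (S := T.image fun s => A.pt s (κ / s)) fun p hp hp0 => ?_).trans
    (Finset.card_image_le.trans hT.le)
  obtain ⟨f, hf, h⟩ := exists_pow_mul_aeval A hQ hv hw hp
  have hf0 : f = 0 := by
    refine Polynomial.eq_zero_of_natDegree_lt_card_of_eval_eq_zero' f T (fun s hs => ?_) (by omega)
    have hs0 : s ≠ 0 := by
      obtain ⟨j, _, rfl⟩ := Finset.mem_image.1 hs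
      positivity
    have hzQ : evalAt (A.pt s (κ / s)) Q = 0 := by
      rw [hQ, map_sub, map_mul, A.eval_u, A.eval_v, eval_C]
      field_simp
      ring
    have h1 := hp0 _ (Finset.mem_image_of_mem _ hs)
    rw [evalAt_eq_of_dvd h hzQ, map_mul, map_pow, evalAt_aeval, A.eval_u] at h1
    refine (mul_eq_zero.1 h1).resolve_left (pow_ne_zero _ ?_)
    intro hw0
    have h2 := congrArg (evalAt (A.pt s (κ / s))) hv
    rw [A.eval_v, map_mul, hw0, mul_zero] at h2
    exact div_ne_zero hκ hs0 h2
  rw [hf0, map_zero, mul_zero, sub_zero] at h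
  exact hl.column_eq_zero_of_dvd hpos hp h

/-- The functional `f ↦ l (w ^ (2 * n) * f(u))` is positive in degree `4 * n`. Strong recursiveness
for `u` and for `v` gives the stability under multiplication and division by `X` that
`exists_quadrature` requires. -/
theorem hasAtoms_of_nondegenerate (A : AffineCoords u v) (hQ : Q = u * v - C κ)
    (hκ : κ ≠ 0) (hv : v = C κ * w) (hw1 : w ∈ polysLE 1) (hw : Q ∣ w * u - 1)
    (hpos : (momentMatrix n β).PosSemidef)
    (hl : IsRieszMod Q n β l) (hrec : StronglyRecursive u v Q n l) : HasAtoms n β := by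
  classical
  let L : ℝ[X] →ₗ[ℝ] ℝ :=
    l ∘ₗ LinearMap.mulLeft ℝ (w ^ (2 * n)) ∘ₗ (Polynomial.aeval u).toLinearMap
  have hL : ∀ f : ℝ[X], L f = l (w ^ (2 * n) * Polynomial.aeval u f) := fun f => rfl
  have hLmul : ∀ f : ℝ[X], L (f * f) =
      l ((w ^ n * Polynomial.aeval u f) * (w ^ n * Polynomial.aeval u f)) := by
    intro f
    rw [hL, map_mul (Polynomial.aeval u)]
    congr 1
    ring
  have hmem : ∀ f : ℝ[X], f.natDegree ≤ 2 * n → w ^ n * Polynomial.aeval u f ∈ polysMod Q n :=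
    fun f hf => pow_mul_aeval_mem_polysMod A.u_mem hw1 hw hf
  have hX : ∀ f : ℝ[X], u * (w ^ n * Polynomial.aeval u f) =
      w ^ n * Polynomial.aeval u (Polynomial.X * f) := by
    intro f
    rw [map_mul, Polynomial.aeval_X]
    ring
  obtain ⟨S, c, hS0, hS, _, hc, hsum⟩ := exists_quadrature L (2 * n)
    (fun f hf => by rw [hLmul]; exact hl.nonneg hpos (hmem f hf))
    (fun f hf h0 => by
      rw [hLmul] at h0 ⊢
      rw [← hX]
      refine hrec _ (hmem f hf.le) h0 u (Or.inl rfl) ?_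
      rw [hX]
      exact hmem _ ((natDegree_X_mul_le (d := 2 * n - 1) (by omega)).trans (by omega)))
    (fun f hf h0 => by
      rw [hLmul] at h0 ⊢
      have hdvd : Q ∣ v * (w ^ n * Polynomial.aeval u (Polynomial.X * f)) -
          κ • (w ^ n * Polynomial.aeval u f) := by
        refine ⟨w ^ n * Polynomial.aeval u f, ?_⟩
        rw [map_mul, Polynomial.aeval_X, smul_eq_C_mul, hQ]
        ring
      have h1 := hrec _ (hmem _ ((natDegree_X_mul_le (d := 2 * n - 1) (by omega)).trans
        (by omega))) h0 v (Or.inr rfl)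
        (polysMod_congr hdvd (Submodule.smul_mem _ _ (hmem f hf.le)))
      rw [hl.congr (dvd_mul_sub_mul hdvd hdvd), smul_mul_smul_comm, map_smul, smul_eq_mul] at h1
      exact (mul_eq_zero.1 h1).resolve_left (mul_ne_zero hκ hκ))
  have hne : ∀ s ∈ S, s ≠ 0 := fun s hs h0 => hS0 (h0 ▸ hs)
  have hcurve : ∀ s ∈ S, evalAt (A.pt s (κ / s)) Q = 0 := by
    intro s hs
    have := hne s hs
    rw [hQ, map_sub, map_mul, A.eval_u, A.eval_v, eval_C]
    field_simp
    ring
  have hw0 : ∀ s ∈ S, evalAt (A.pt s (κ / s)) w = s⁻¹ := by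
    intro s hs
    have h2 := congrArg (evalAt (A.pt s (κ / s))) hv
    rw [A.eval_v, map_mul, eval_C] at h2
    have := hne s hs
    field_simp at h2 ⊢
    linarith
  have hinj : ∀ s t : ℝ, A.pt s (κ / s) = A.pt t (κ / t) → s = t := by
    intro s t hst
    have := A.eval_u s (κ / s)
    rwa [hst, A.eval_u, eq_comm] at this
  have hsep : Separates n (S.image fun s => A.pt s (κ / s)) := by
    refine separates_of_card_le A hQ hκ hw1 hw (fun z hz => ?_) (Finset.card_image_le.trans hS)
    obtain ⟨s, hs, rfl⟩ := Finset.mem_image.1 hz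
    exact hcurve s hs
  -- The factor `s ^ (2 * n)` undoes `w ^ (2 * n)`; the even power keeps the masses positive.
  refine ⟨S.image fun s => A.pt s (κ / s), fun z => c (evalAt z u) * evalAt z u ^ (2 * n), ?_, ?_,
    hsep.mono_degree (Nat.le_succ n), Or.inl hsep⟩
  · intro z hz
    obtain ⟨s, hs, rfl⟩ := Finset.mem_image.1 hz
    dsimp only
    rw [A.eval_u, pow_mul]
    exact mul_pos (hc s hs) (pow_pos (pow_pos (abs_pos.2 (hne s hs)) 2 |>.trans_eq (sq_abs s)) n)
  · intro p hp
    obtain ⟨f, hf, h⟩ := exists_pow_mul_aeval A hQ hv hw hp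
    rw [← hl.eq_riesz p hp, hl.congr h, ← hL, hsum f (by omega),
      Finset.sum_image fun s _ t _ hst => hinj s t hst]
    refine Finset.sum_congr rfl fun s hs => ?_
    dsimp only
    rw [evalAt_eq_of_dvd h (hcurve s hs), map_mul, map_pow, evalAt_aeval, A.eval_u, hw0 s hs, inv_pow]
    have := pow_ne_zero (2 * n) (hne s hs)
    field_simp

/-- Exactly `rank M(n) ≤ 2 * n + 1` points of the variety are chosen; so few points on the curve are
separated in degree `n`. -/
theorem stronglyRecursive_of_nondegenerate (A : AffineCoords u v) (hQ : Q = u * v - C κ)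
    (hκ : κ ≠ 0) (hv : v = C κ * w) (hw1 : w ∈ polysLE 1) (hw : Q ∣ w * u - 1)
    (hpos : (momentMatrix n β).PosSemidef) (hl : IsRieszMod Q n β l)
    (hVQ : ∀ z ∈ variety n β, evalAt z Q = 0)
    (hr : ((momentMatrix n β).rank : ℕ∞) ≤ (variety n β).encard) :
    StronglyRecursive u v Q n l := by
  obtain ⟨T, hTV, hT⟩ := Set.exists_subset_encard_eq hr
  have hfin : T.Finite := Set.finite_of_encard_eq_coe hT
  lift T to Finset (ℝ × ℝ) using hfin
  rw [Set.encard_coe_eq_coe_finsetCard, Nat.cast_inj] at hT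
  refine stronglyRecursive_of_separates hl hpos (S := T) (fun z hz => hVQ z (hTV hz))
    (fun z hz => hTV hz) ?_ hT.ge
  refine separates_of_card_le A hQ hκ hw1 hw (fun z hz => hVQ z (hTV hz)) ?_
  rw [hT]
  exact rank_le_of_nondegenerate A hQ hκ hv hw hpos hl

end Nondegenerate

end TruncMoment

/-! ### The degenerate hyperbola: two crossing lines -/

namespace TruncMoment

open MvPolynomial
open scoped Polynomial

/-- The function on two crossing lines with restrictions `a` and `b`, where `a 0 = b 0`. -/
noncomputable def glue (u v : MvPolynomial (Fin 2) ℝ) (a b : ℝ[X]) : MvPolynomial (Fin 2) ℝ :=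
  Polynomial.aeval u a + Polynomial.aeval v b - C (a.eval 0)

section Degenerate

variable {u v Q : MvPolynomial (Fin 2) ℝ} {n : ℕ} {β : ℕ → ℕ → ℝ}
  {l : MvPolynomial (Fin 2) ℝ →ₗ[ℝ] ℝ}

theorem AffineCoords.glue_mem (A : AffineCoords u v) {a b : ℝ[X]} {k : ℕ} (ha : a.natDegree ≤ k)
    (hb : b.natDegree ≤ k) : glue u v a b ∈ polysLE k :=
  Submodule.sub_mem _ (Submodule.add_mem _ (aeval_mem_polysLE A.u_mem ha)
    (aeval_mem_polysLE A.v_mem hb)) (C_mem_polysLE _ _)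

theorem AffineCoords.eval_glue_u (A : AffineCoords u v) {a b : ℝ[X]} (hab : a.eval 0 = b.eval 0)
    (s : ℝ) : evalAt (A.pt s 0) (glue u v a b) = a.eval s := by
  rw [glue, map_sub, map_add, evalAt_aeval, evalAt_aeval, A.eval_u, A.eval_v, eval_C, hab]
  ring

theorem AffineCoords.eval_glue_v (A : AffineCoords u v) {a b : ℝ[X]}
    (t : ℝ) : evalAt (A.pt 0 t) (glue u v a b) = b.eval t := by
  rw [glue, map_sub, map_add, evalAt_aeval, evalAt_aeval, A.eval_u, A.eval_v, eval_C]
  ring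

theorem AffineCoords.exists_glue (A : AffineCoords u v) (hQ : Q = u * v - C 0) {k : ℕ}
    {p : MvPolynomial (Fin 2) ℝ} (hp : p ∈ polysLE k) :
    ∃ a b : ℝ[X], a.natDegree ≤ k ∧ b.natDegree ≤ k ∧ a.eval 0 = b.eval 0 ∧
      Q ∣ p - glue u v a b := by
  obtain ⟨a, b, ha, hb, h⟩ := mem_sumPolys.1 (A.polysLE_le_sumPolys hQ k hp)
  -- Exchanging constants makes both values at the crossing `a(0) + b(0)`, which `glue` subtracts
  -- once.
  refine ⟨a + Polynomial.C (b.eval 0), b + Polynomial.C (a.eval 0),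
    (Polynomial.natDegree_add_C).trans_le ha, (Polynomial.natDegree_add_C).trans_le hb,
    by simp [add_comm], ?_⟩
  have e : glue u v (a + Polynomial.C (b.eval 0)) (b + Polynomial.C (a.eval 0)) =
      Polynomial.aeval u a + Polynomial.aeval v b := by
    simp only [glue, map_add, Polynomial.aeval_C, MvPolynomial.algebraMap_eq, Polynomial.eval_add,
      Polynomial.eval_C]
    ring
  rwa [e]

theorem aeval_eq_mul_add (u : MvPolynomial (Fin 2) ℝ) (a : ℝ[X]) :
    Polynomial.aeval u a = u * Polynomial.aeval u a.divX + C (a.eval 0) := by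
  conv_lhs => rw [← a.divX_mul_X_add]
  simp [MvPolynomial.algebraMap_eq, mul_comm, Polynomial.coeff_zero_eq_eval_zero]

/-- Modulo `u * v` the cross terms vanish, so squaring acts on each line separately. -/
theorem dvd_glue_mul_glue (hQ : Q = u * v - C 0) {a b : ℝ[X]} (hab : a.eval 0 = b.eval 0) :
    Q ∣ glue u v a b * glue u v a b - glue u v (a * a) (b * b) := by
  refine ⟨2 * Polynomial.aeval u a.divX * Polynomial.aeval v b.divX, ?_⟩
  simp only [glue, map_mul, Polynomial.eval_mul]
  rw [aeval_eq_mul_add u a, aeval_eq_mul_add v b, hab, hQ, C_0]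
  ring

theorem dvd_mul_glue_sub (hQ : Q = u * v - C 0) {a b : ℝ[X]} (hab : a.eval 0 = b.eval 0) :
    Q ∣ u * glue u v a b - Polynomial.aeval u (Polynomial.X * a) := by
  refine ⟨Polynomial.aeval v b.divX, ?_⟩
  simp only [glue, map_mul, Polynomial.aeval_X]
  rw [aeval_eq_mul_add v b, hab, hQ, C_0]
  ring

theorem map_C (l : MvPolynomial (Fin 2) ℝ →ₗ[ℝ] ℝ) (c : ℝ) : l (C c) = l 1 * c := by
  rw [← mul_one (C c), ← smul_eq_C_mul, map_smul, smul_eq_mul, mul_comm]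

theorem map_glue (l : MvPolynomial (Fin 2) ℝ →ₗ[ℝ] ℝ) (a b : ℝ[X]) :
    l (glue u v a b) =
      l (Polynomial.aeval u a) + l (Polynomial.aeval v b) - l 1 * a.eval 0 := by
  rw [glue, map_sub, map_add, map_C]

theorem IsRieszMod.glue_mul_self (hl : IsRieszMod Q n β l) (hQ : Q = u * v - C 0) {a b : ℝ[X]}
    (hab : a.eval 0 = b.eval 0) :
    l (glue u v a b * glue u v a b) = l (Polynomial.aeval u (a * a)) +
      l (Polynomial.aeval v (b * b)) - l 1 * a.eval 0 ^ 2 := by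
  rw [hl.congr (dvd_glue_mul_glue hQ hab), map_glue, Polynomial.eval_mul, sq]

/-- Interpolation on two crossing lines, at the nodes `U` on the first line and at the origin and the
nodes `V` on the second line. -/
theorem AffineCoords.separates_of_axes (A : AffineCoords u v) {U V : Finset ℝ}
    {S : Finset (ℝ × ℝ)} (hU : U.card ≤ n + 1) (hV : (insert 0 V).card ≤ n + 1)
    (hS : ∀ z ∈ S, (∃ s ∈ U, z = A.pt s 0) ∨ ∃ t ∈ V, t ≠ 0 ∧ z = A.pt 0 t) :
    Separates n S := by
  classical
  intro φ
  have hinj : ∀ T : Finset ℝ, Set.InjOn (id : ℝ → ℝ) (T : Set ℝ) :=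
    fun T => Function.injective_id.injOn
  have hdeg : ∀ (T : Finset ℝ) (r : ℝ → ℝ), T.card ≤ n + 1 →
      (Lagrange.interpolate T id r).natDegree ≤ n := by
    intro T r hT
    rw [← mem_degreeLT_succ, Polynomial.mem_degreeLT]
    exact (Lagrange.degree_interpolate_lt _ (hinj T)).trans_le (by exact_mod_cast hT)
  have heval : ∀ (T : Finset ℝ) (r : ℝ → ℝ), ∀ s ∈ T,
      (Lagrange.interpolate T id r).eval s = r s := fun T r s hs =>
    Lagrange.eval_interpolate_at_node (v := id) r (hinj T) hs
  set a := Lagrange.interpolate U id fun s => φ (A.pt s 0)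
  -- The extra node `0` forces the second interpolant to agree with the first at the crossing.
  set b := Lagrange.interpolate (insert 0 V) id fun t => if t = 0 then a.eval 0 else φ (A.pt 0 t)
    with hb
  have hab : a.eval 0 = b.eval 0 := by
    rw [hb, heval _ _ 0 (Finset.mem_insert_self _ _), if_pos rfl]
  refine ⟨glue u v a b, A.glue_mem (hdeg _ _ hU) (hdeg _ _ hV), fun z hz => ?_⟩
  rcases hS z hz with ⟨s, hs, rfl⟩ | ⟨t, ht, ht0, rfl⟩
  · rw [A.eval_glue_u hab, heval _ _ s hs]
  · rw [A.eval_glue_v, hb, heval _ _ t (Finset.mem_insert_of_mem ht), if_neg ht0]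

/-- The crossing and `n` further points on each line determine a function of degree at most `n` on
the union. -/
theorem rank_le_of_degenerate (A : AffineCoords u v) (hQ : Q = u * v - C 0)
    (hpos : (momentMatrix n β).PosSemidef) (hl : IsRieszMod Q n β l) :
    (momentMatrix n β).rank ≤ 2 * n + 1 := by
  classical
  let T : Finset ℝ := (Finset.range n).image fun j : ℕ => (j : ℝ) + 1
  have hT : T.card = n := by
    rw [Finset.card_image_of_injective, Finset.card_range]
    intro i j hij
    have : (i : ℝ) = j := by simpa using hij
    exact_mod_cast this
  have hT0 : (0 : ℝ) ∉ T := by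
    intro h
    obtain ⟨j, _, hj⟩ := Finset.mem_image.1 h
    have : (0 : ℝ) < (j : ℝ) + 1 := by positivity
    exact this.ne' hj
  have hT1 : (insert 0 T).card = n + 1 := by rw [Finset.card_insert_of_notMem hT0, hT]
  refine (rank_le_card (S := (insert 0 T).image (fun s => A.pt s 0) ∪ T.image (fun t => A.pt 0 t))
    fun p hp hp0 => ?_).trans ((Finset.card_union_le _ _).trans ((add_le_add Finset.card_image_le
      Finset.card_image_le).trans (by omega)))
  obtain ⟨a, b, ha, hb, hab, h⟩ := A.exists_glue hQ hp
  have hQ0 : ∀ s t, s * t = 0 → evalAt (A.pt s t) Q = 0 := by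
    intro s t hst
    rw [hQ, map_sub, map_mul, A.eval_u, A.eval_v, eval_C, hst, sub_zero]
  have ha0 : a = 0 := by
    refine Polynomial.eq_zero_of_natDegree_lt_card_of_eval_eq_zero' a (insert 0 T)
      (fun s hs => ?_) (by omega)
    rw [← A.eval_glue_u hab, ← evalAt_eq_of_dvd h (hQ0 _ _ (mul_zero s))]
    exact hp0 _ (Finset.mem_union_left _ (Finset.mem_image_of_mem _ hs))
  have hb0 : b = 0 := by
    refine Polynomial.eq_zero_of_natDegree_lt_card_of_eval_eq_zero' b (insert 0 T)
      (fun s hs => ?_) (by omega)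
    rcases Finset.mem_insert.1 hs with rfl | hs
    · rw [← hab, ha0, Polynomial.eval_zero]
    · rw [← A.eval_glue_v (a := a), ← evalAt_eq_of_dvd h (hQ0 _ _ (zero_mul s))]
      exact hp0 _ (Finset.mem_union_right _ (Finset.mem_image_of_mem _ hs))
  rw [ha0, hb0, glue, map_zero, map_zero, Polynomial.eval_zero, C_0, add_zero, sub_zero,
    sub_zero] at h
  exact hl.column_eq_zero_of_dvd hpos hp h

/-- The part of strong recursiveness that concerns `u`, with the first and the second axis
uncoupled. -/
theorem StronglyRecursive.axis (A : AffineCoords u v) (hQ : Q = u * v - C 0)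
    (hl : IsRieszMod Q n β l) (hrec : StronglyRecursive u v Q n l) {a b : ℝ[X]}
    (ha : a.natDegree < n) (hb : b.natDegree ≤ n) (hab : a.eval 0 = b.eval 0)
    (h0 : l (Polynomial.aeval u (a * a)) + l (Polynomial.aeval v (b * b)) -
      l 1 * a.eval 0 ^ 2 = 0) :
    l (Polynomial.aeval u ((Polynomial.X * a) * (Polynomial.X * a))) = 0 := by
  have hdvd := dvd_mul_glue_sub hQ hab
  rw [map_mul, ← hl.congr (dvd_mul_sub_mul hdvd hdvd)]
  -- Multiplication by `u` kills the second line, so the product has degree at most `n` modulo `Q`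
  -- even when `b` has degree `n`. Ordinary recursiveness does not cover this.
  refine hrec _ (polysLE_le_polysMod Q n (A.glue_mem ha.le hb))
    ((hl.glue_mul_self hQ hab).trans h0) u (Or.inl rfl) (polysMod_congr hdvd ?_)
  refine polysLE_le_polysMod Q n (aeval_mem_polysLE A.u_mem ?_)
  exact (natDegree_X_mul_le (d := n - 1) (by omega)).trans (by omega)

theorem StronglyRecursive.swap (hrec : StronglyRecursive u v Q n l) :
    StronglyRecursive v u Q n l :=
  fun p hp h0 q hq => hrec p hp h0 q hq.symm

theorem hasAtoms_of_degenerate (A : AffineCoords u v) (hQ : Q = u * v - C 0) (hn : 1 ≤ n)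
    (hpos : (momentMatrix n β).PosSemidef) (hl : IsRieszMod Q n β l)
    (hrec : StronglyRecursive u v Q n l) : HasAtoms n β := by
  classical
  have hQ' : Q = v * u - C 0 := by rw [hQ, mul_comm]
  obtain ⟨S, T, w, w', e, hS0, hT0, he, hw, hw', hcard, hsum⟩ := exists_cross_quadrature
    (l ∘ₗ (Polynomial.aeval u).toLinearMap) (l ∘ₗ (Polynomial.aeval v).toLinearMap) hn
    (by simp) (fun a b ha hb hab => by
      have := hl.nonneg hpos (polysLE_le_polysMod Q n (A.glue_mem ha hb))
      rw [hl.glue_mul_self hQ hab] at this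
      simpa using this)
    (fun a b ha hb hab h0 => by
      have h0' : l (Polynomial.aeval u (a * a)) + l (Polynomial.aeval v (b * b)) -
          l 1 * a.eval 0 ^ 2 = 0 := by simpa using h0
      refine ⟨fun h => hrec.axis A hQ hl h hb hab h0', fun h => ?_⟩
      refine hrec.swap.axis A.swap hQ' hl h ha hab.symm ?_
      rw [← hab]
      linarith)
  have hsum' : ∀ a b : ℝ[X], a.natDegree ≤ 2 * n → b.natDegree ≤ 2 * n → a.eval 0 = b.eval 0 →
      l (glue u v a b) = ∑ s ∈ S, w s * a.eval s + ∑ t ∈ T, w' t * b.eval t + e * a.eval 0 := by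
    intro a b ha hb hab
    rw [map_glue, ← hsum a b ha hb hab]
    simp
  have hS : ∀ s ∈ S, s ≠ 0 := fun s hs h => hS0 (h ▸ hs)
  have hT : ∀ t ∈ T, t ≠ 0 := fun t ht h => hT0 (h ▸ ht)
  -- All atoms must have positive mass, so the crossing is included only when `e ≠ 0`.
  let E : Finset (ℝ × ℝ) := if e = 0 then ∅ else {A.pt 0 0}
  let S' := S.image fun s => A.pt s 0
  let T' := T.image fun t => A.pt 0 t
  have hinjS : Function.Injective fun s => A.pt s 0 := fun s t h => by
    have := congrArg (fun z => evalAt z u) h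
    simpa only [A.eval_u] using this
  have hinjT : Function.Injective fun t => A.pt 0 t := fun s t h => by
    have := congrArg (fun z => evalAt z v) h
    simpa only [A.eval_v] using this
  have hdST : Disjoint S' T' := by
    rw [Finset.disjoint_left]
    intro z hz hz'
    obtain ⟨s, hs, rfl⟩ := Finset.mem_image.1 hz
    obtain ⟨t, ht, h⟩ := Finset.mem_image.1 hz'
    have := congrArg (fun z => evalAt z u) h
    simp only [A.eval_u] at this
    exact hS s hs this.symm
  have hE : ∀ z ∈ E, z = A.pt 0 0 ∧ e ≠ 0 := by
    intro z hz
    by_cases h : e = 0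
    · simp [E, h] at hz
    · simp only [E, if_neg h, Finset.mem_singleton] at hz
      exact ⟨hz, h⟩
  have hdE : Disjoint (S' ∪ T') E := by
    rw [Finset.disjoint_left]
    intro z hz hz'
    obtain ⟨rfl, -⟩ := hE z hz'
    rcases Finset.mem_union.1 hz with hz | hz
    · obtain ⟨s, hs, h⟩ := Finset.mem_image.1 hz
      exact hS s hs (hinjS h)
    · obtain ⟨s, hs, h⟩ := Finset.mem_image.1 hz
      exact hT s hs (hinjT h)
  have hmem : ∀ z ∈ (S' ∪ T') ∪ E, (∃ s ∈ S, z = A.pt s 0) ∨ (∃ t ∈ T, z = A.pt 0 t) ∨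
      (z = A.pt 0 0 ∧ e ≠ 0) := by
    intro z hz
    rcases Finset.mem_union.1 hz with hz | hz
    · rcases Finset.mem_union.1 hz with hz | hz
      · obtain ⟨s, hs, rfl⟩ := Finset.mem_image.1 hz
        exact Or.inl ⟨s, hs, rfl⟩
      · obtain ⟨t, ht, rfl⟩ := Finset.mem_image.1 hz
        exact Or.inr (Or.inl ⟨t, ht, rfl⟩)
    · exact Or.inr (Or.inr (hE z hz))
  have hTins : (insert 0 T).card = T.card + 1 := Finset.card_insert_of_notMem hT0
  have hSins : (insert 0 S).card = S.card + 1 := Finset.card_insert_of_notMem hS0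
  refine ⟨(S' ∪ T') ∪ E, fun z => if evalAt z u ≠ 0 then w (evalAt z u) else
    if evalAt z v ≠ 0 then w' (evalAt z v) else e, ?_, ?_, ?_⟩
  · intro z hz
    dsimp only
    rcases hmem z hz with ⟨s, hs, rfl⟩ | ⟨t, ht, rfl⟩ | ⟨rfl, h⟩
    · rw [A.eval_u, if_pos (hS s hs)]
      exact hw s hs
    · rw [A.eval_u, if_neg (not_not.2 rfl), A.eval_v, if_pos (hT t ht)]
      exact hw' t ht
    · rw [A.eval_u, if_neg (not_not.2 rfl), A.eval_v, if_neg (not_not.2 rfl)]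
      exact lt_of_le_of_ne he h.symm
  · intro p hp
    obtain ⟨a, b, ha, hb, hab, h⟩ := A.exists_glue hQ hp
    have hQ0 : ∀ s t, s * t = 0 → evalAt (A.pt s t) Q = 0 := by
      intro s t hst
      rw [hQ, map_sub, map_mul, A.eval_u, A.eval_v, eval_C, hst, sub_zero]
    rw [← hl.eq_riesz p hp, hl.congr h, hsum' a b ha hb hab, Finset.sum_union hdE,
      Finset.sum_union hdST, Finset.sum_image fun s _ t _ h => hinjS h,
      Finset.sum_image fun s _ t _ h => hinjT h]
    congr 1
    · congr 1
      · refine Finset.sum_congr rfl fun s hs => ?_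
        dsimp only
        rw [A.eval_u, if_pos (hS s hs), evalAt_eq_of_dvd h (hQ0 _ _ (mul_zero s)),
          A.eval_glue_u hab]
      · refine Finset.sum_congr rfl fun t ht => ?_
        dsimp only
        rw [A.eval_u, if_neg (not_not.2 rfl), A.eval_v, if_pos (hT t ht),
          evalAt_eq_of_dvd h (hQ0 _ _ (zero_mul t)), A.eval_glue_v]
    · by_cases h0 : e = 0
      · simp [E, h0]
      · simp only [E, if_neg h0, Finset.sum_singleton]
        rw [A.eval_u, if_neg (not_not.2 rfl), A.eval_v, if_neg (not_not.2 rfl),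
          evalAt_eq_of_dvd h (hQ0 _ _ (zero_mul 0)), A.eval_glue_u hab]
  · rcases hcard with ⟨hSn, hTn⟩ | ⟨he0, hSn, hTn⟩
    · have hsep : Separates n ((S' ∪ T') ∪ E) := by
        refine A.separates_of_axes (U := insert 0 S) (V := T) (by omega) (by omega) fun z hz => ?_
        rcases hmem z hz with ⟨s, hs, rfl⟩ | ⟨t, ht, rfl⟩ | ⟨rfl, h⟩
        · exact Or.inl ⟨s, Finset.mem_insert_of_mem hs, rfl⟩
        · exact Or.inr ⟨t, ht, hT t ht, rfl⟩
        · exact Or.inl ⟨0, Finset.mem_insert_self _ _, rfl⟩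
      exact ⟨hsep.mono_degree (Nat.le_succ n), Or.inl hsep⟩
    · have hE0 : E = ∅ := by simp [E, he0]
      have hmem' : ∀ z ∈ (S' ∪ T') ∪ E, (∃ s ∈ S, z = A.pt s 0) ∨ (∃ t ∈ T, z = A.pt 0 t) := by
        intro z hz
        rcases hmem z hz with h | h | ⟨_, h⟩
        exacts [Or.inl h, Or.inr h, absurd he0 h]
      have hsep1 : Separates (n + 1) ((S' ∪ T') ∪ E) := by
        refine A.separates_of_axes (U := S) (V := T) (by omega) (by omega) fun z hz => ?_
        rcases hmem' z hz with h | ⟨t, ht, h⟩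
        exacts [Or.inl h, Or.inr ⟨t, ht, hT t ht, h⟩]
      refine ⟨hsep1, ?_⟩
      by_cases hTn' : T.card ≤ n
      · left
        refine A.separates_of_axes (U := S) (V := T) (by omega) (by omega) fun z hz => ?_
        rcases hmem' z hz with h | ⟨t, ht, h⟩
        exacts [Or.inl h, Or.inr ⟨t, ht, hT t ht, h⟩]
      by_cases hSn' : S.card ≤ n
      · left
        refine A.swap.separates_of_axes (U := T) (V := S) (by omega) (by omega) fun z hz => ?_
        rcases hmem' z hz with ⟨s, hs, h⟩ | ⟨t, ht, h⟩
        exacts [Or.inr ⟨s, hs, hS s hs, h⟩, Or.inl ⟨t, ht, h⟩]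
      · right
        -- Both lines carry `n + 1` atoms away from the crossing: one too many for separation in
        -- degree `n`, so one atom is dropped.
        obtain ⟨t0, ht0⟩ := Finset.card_pos.1 (show 0 < T.card by omega)
        refine ⟨A.pt 0 t0, Finset.mem_union_left _ (Finset.mem_union_right _
          (Finset.mem_image_of_mem _ ht0)), ?_, ?_⟩
        · have h0 : (insert 0 (T.erase t0)).card ≤ n + 1 := by
            have := Finset.card_erase_of_mem ht0
            exact (Finset.card_insert_le _ _).trans (by omega)
          refine A.separates_of_axes (U := S) (V := T.erase t0) (by omega) h0 fun z hz => ?_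
          rw [Finset.mem_erase] at hz
          rcases hmem' z hz.2 with h | ⟨t, ht, rfl⟩
          · exact Or.inl h
          · refine Or.inr ⟨t, Finset.mem_erase.2 ⟨?_, ht⟩, hT t ht, rfl⟩
            rintro rfl
            exact hz.1 rfl
        · rw [hE0, Finset.union_empty, Finset.card_union_of_disjoint hdST,
            Finset.card_image_of_injective _ hinjS, Finset.card_image_of_injective _ hinjT]
          omega

/-- If all null polynomials vanish at the intersection point of the two lines, then the two lines
do not interact and ordinary recursiveness suffices. -/
theorem null_mul_of_eval_origin (A : AffineCoords u v) (hQ : Q = u * v - C 0) (hn : 2 ≤ n)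
    (hpos : (momentMatrix n β).PosSemidef) (hrec : RecursivelyGenerated n β)
    (hl : IsRieszMod Q n β l)
    (hO : ∀ p ∈ polysMod Q n, l (p * p) = 0 → evalAt (A.pt 0 0) p = 0)
    {p : MvPolynomial (Fin 2) ℝ} (hp : p ∈ polysMod Q n) (h0 : l (p * p) = 0)
    (hup : u * p ∈ polysMod Q n) : l ((u * p) * (u * p)) = 0 := by
  obtain ⟨p', hp', hpp'⟩ := mem_polysMod.1 hp
  obtain ⟨a, b, ha, hb, hab, h⟩ := A.exists_glue hQ hp'
  have hpg : Q ∣ p - glue u v a b := by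
    have := dvd_add hpp' h
    rwa [sub_add_sub_cancel] at this
  obtain ⟨r, hr, hpr⟩ := mem_polysMod.1 hup
  obtain ⟨a', b', ha', hb', hab', h'⟩ := A.exists_glue hQ hr
  have hQ0 : ∀ s, evalAt (A.pt s 0) Q = 0 := by
    intro s
    rw [hQ, map_sub, map_mul, A.eval_v, mul_zero, eval_C, sub_zero]
  have ha0 : a.eval 0 = 0 := by
    rw [← A.eval_glue_u hab, ← evalAt_eq_of_dvd hpg (hQ0 0)]
    exact hO p hp h0
  -- Restricting `u * p` to the first line shows that `X * a` has degree at most `n`, so ordinary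
  -- recursiveness applies to `a(u)`.
  have hXa : Polynomial.X * a = a' := by
    refine Polynomial.funext fun s => ?_
    rw [← A.eval_glue_u hab' s, ← evalAt_eq_of_dvd h' (hQ0 s), ← evalAt_eq_of_dvd hpr (hQ0 s),
      map_mul, evalAt_eq_of_dvd hpg (hQ0 s), A.eval_glue_u hab, A.eval_u, Polynomial.eval_mul,
      Polynomial.eval_X]
  have had : a.natDegree + 1 ≤ n := by
    rcases eq_or_ne a 0 with rfl | hane
    · simp; omega
    · rw [← hXa, Polynomial.natDegree_X_mul hane] at ha'
      exact ha'
  have hmem : Polynomial.aeval u a ∈ polysLE n := aeval_mem_polysLE A.u_mem ha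
  -- With `a(0) = 0` the correction term disappears, and two nonnegative terms with sum `0` both
  -- vanish.
  have hsq : l (Polynomial.aeval u a * Polynomial.aeval u a) = 0 := by
    have h1 := hl.nonneg hpos (polysLE_le_polysMod Q n hmem)
    have h2 := hl.nonneg hpos (polysLE_le_polysMod Q n (aeval_mem_polysLE A.v_mem hb))
    rw [hl.congr (dvd_mul_sub_mul hpg hpg), hl.glue_mul_self hQ hab, ha0,
      map_mul (Polynomial.aeval u), map_mul (Polynomial.aeval v)] at h0
    nlinarith
  have hcol : column n β (Polynomial.aeval u a) = 0 :=
    (hl.column_eq_zero_iff hpos hmem (by rw [sub_self]; exact dvd_zero Q)).2 hsq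
  have hmem' : Polynomial.aeval u a * u ∈ polysLE n :=
    polysLE_mono had (mul_mem_polysLE (aeval_mem_polysLE A.u_mem le_rfl) A.u_mem)
  have hcol' := hrec _ u (mem_polysLE.1 hmem) (mem_polysLE.1 (polysLE_mono (by omega) A.u_mem))
    (mem_polysLE.1 hmem') hcol
  refine (hl.column_eq_zero_iff hpos hmem' ?_).1 hcol'
  have h1 := dvd_add (hpg.mul_left u) (dvd_mul_glue_sub hQ hab)
  have e : u * (p - glue u v a b) + (u * glue u v a b -
      Polynomial.aeval u (Polynomial.X * a)) = u * p - Polynomial.aeval u a * u := by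
    rw [map_mul, Polynomial.aeval_X]
    ring
  rwa [e] at h1

/-- A line through more than `n` points of the variety lies in the variety. -/
theorem finite_axis_of_origin_notMem (A : AffineCoords u v) (hQ : Q = u * v - C 0)
    (hO : A.pt 0 0 ∉ variety n β) :
    ∃ U : Finset ℝ, U.card ≤ n ∧ (0 : ℝ) ∉ U ∧ ∀ s, A.pt s 0 ∈ variety n β ↔ s ∈ U := by
  have hle : {s | A.pt s 0 ∈ variety n β}.encard ≤ (n : ℕ∞) := by
    by_contra! hlt
    obtain ⟨T, hTV, hT⟩ := Set.exists_subset_encard_eq (Order.add_one_le_of_lt hlt)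
    have hT' : T.encard = ((n + 1 : ℕ) : ℕ∞) := by rw [hT]; push_cast; rfl
    have hfin : T.Finite := Set.finite_of_encard_eq_coe hT'
    lift T to Finset ℝ using hfin
    rw [Set.encard_coe_eq_coe_finsetCard, Nat.cast_inj] at hT'
    apply hO
    rw [mem_variety_iff]
    intro p hp h0
    obtain ⟨a, b, ha, hb, hab, h⟩ := A.exists_glue hQ hp
    have hQ0 : ∀ s, evalAt (A.pt s 0) Q = 0 := by
      intro s
      rw [hQ, map_sub, map_mul, A.eval_v, mul_zero, eval_C, sub_zero]
    have hev : ∀ s, evalAt (A.pt s 0) p = a.eval s := fun s => by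
      rw [evalAt_eq_of_dvd h (hQ0 s), A.eval_glue_u hab]
    have : a = 0 := by
      refine Polynomial.eq_zero_of_natDegree_lt_card_of_eval_eq_zero' a T (fun s hs => ?_)
        (by omega)
      rw [← hev]
      exact mem_variety_iff.1 (hTV hs) p hp h0
    rw [hev, this, Polynomial.eval_zero]
  have hfin : {s | A.pt s 0 ∈ variety n β}.Finite := Set.finite_of_encard_le_coe hle
  refine ⟨hfin.toFinset, ?_, by simpa using hO, fun s => by simp⟩
  rw [hfin.encard_eq_coe_toFinset_card] at hle
  exact_mod_cast hle

/-- If the crossing lies in the variety, null functions vanish there and the lines decouple.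
Otherwise each line meets the variety in at most `n` points; together they are separated in degree
`n`, and the rank count applies. -/
theorem stronglyRecursive_of_degenerate (A : AffineCoords u v) (hQ : Q = u * v - C 0) (hn : 2 ≤ n)
    (hpos : (momentMatrix n β).PosSemidef) (hrec : RecursivelyGenerated n β)
    (hl : IsRieszMod Q n β l) (hVQ : ∀ z ∈ variety n β, evalAt z Q = 0)
    (hr : ((momentMatrix n β).rank : ℕ∞) ≤ (variety n β).encard) :
    StronglyRecursive u v Q n l := by
  classical
  have hQ' : Q = v * u - C 0 := by rw [hQ, mul_comm]
  by_cases hO : A.pt 0 0 ∈ variety n β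
  · have hO' : ∀ p ∈ polysMod Q n, l (p * p) = 0 → evalAt (A.pt 0 0) p = 0 := by
      intro p hp h0
      obtain ⟨r, hr, hpr⟩ := mem_polysMod.1 hp
      rw [evalAt_eq_of_dvd hpr (hVQ _ hO)]
      exact mem_variety_iff.1 hO r hr ((hl.column_eq_zero_iff hpos hr hpr).2 h0)
    intro p hp h0 q hq hqp
    rcases hq with rfl | rfl
    · exact null_mul_of_eval_origin A hQ hn hpos hrec hl hO' hp h0 hqp
    · exact null_mul_of_eval_origin A.swap hQ' hn hpos hrec hl hO' hp h0 hqp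
  · obtain ⟨U, hU, hU0, hUV⟩ := finite_axis_of_origin_notMem A hQ hO
    obtain ⟨V, hV, hV0, hVV⟩ := finite_axis_of_origin_notMem A.swap hQ' hO
    have hmem : ∀ z ∈ variety n β, (∃ s ∈ U, z = A.pt s 0) ∨ ∃ t ∈ V, t ≠ 0 ∧ z = A.pt 0 t := by
      intro z hz
      have hz0 := hVQ z hz
      rw [hQ, map_sub, map_mul, eval_C, sub_zero] at hz0
      have hpt := A.pt_eval z
      rcases mul_eq_zero.1 hz0 with h | h
      · rw [h] at hpt
        have ht : evalAt z v ∈ V := (hVV _).1 (by rw [← hpt] at hz; exact hz)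
        exact Or.inr ⟨_, ht, fun h0 => hV0 (h0 ▸ ht), hpt.symm⟩
      · rw [h] at hpt
        exact Or.inl ⟨_, (hUV _).1 (by rw [hpt]; exact hz), hpt.symm⟩
    have hfin : (variety n β).Finite := by
      refine ((U.image fun s => A.pt s 0) ∪ V.image fun t => A.pt 0 t).finite_toSet.subset ?_
      intro z hz
      rw [Finset.mem_coe, Finset.mem_union, Finset.mem_image, Finset.mem_image]
      rcases hmem z hz with ⟨s, hs, h⟩ | ⟨t, ht, _, h⟩
      exacts [Or.inl ⟨s, hs, h.symm⟩, Or.inr ⟨t, ht, h.symm⟩]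
    rw [hfin.encard_eq_coe_toFinset_card, Nat.cast_le] at hr
    refine stronglyRecursive_of_separates hl hpos (S := hfin.toFinset)
      (fun z hz => hVQ z (by simpa using hz)) (fun z hz => by simpa using hz) ?_ hr
    exact A.separates_of_axes (U := U) (V := V) (by omega)
      ((Finset.card_insert_le _ _).trans (by omega)) fun z hz => hmem z (by simpa using hz)

end Degenerate

end TruncMoment

/-! ### Representing measures and the variety -/

namespace TruncMoment

open MvPolynomial MeasureTheory

section Measures

variable {n : ℕ} {β : ℕ → ℕ → ℝ} {μ : Measure (ℝ × ℝ)}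

theorem evalAt_eq_sum (z : ℝ × ℝ) (p : MvPolynomial (Fin 2) ℝ) :
    evalAt z p = ∑ m ∈ p.support, coeff m p * (z.2 ^ m 1 * z.1 ^ m 0) := by
  conv_lhs => rw [p.as_sum]
  rw [map_sum]
  exact Finset.sum_congr rfl fun m _ => evalAt_monomial z m _

theorem add_le_of_mem_support {m : ℕ} {p : MvPolynomial (Fin 2) ℝ} (hp : p ∈ polysLE m)
    {k : Fin 2 →₀ ℕ} (hk : k ∈ p.support) : k 1 + k 0 ≤ m := by
  have := (le_totalDegree hk).trans (mem_polysLE.1 hp)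
  rw [degree_eq] at this
  omega

theorem HasMoments.integrable {m : ℕ} (hμ : HasMoments m μ) {p : MvPolynomial (Fin 2) ℝ}
    (hp : p ∈ polysLE m) : Integrable (fun z => evalAt z p) μ := by
  simp only [evalAt_eq_sum]
  exact integrable_finsetSum _ fun k hk => (hμ _ _ (add_le_of_mem_support hp hk)).const_mul _

theorem IsRepresenting.riesz_eq (hμ : IsRepresenting n β μ) {p : MvPolynomial (Fin 2) ℝ}
    (hp : p ∈ polysLE (2 * n)) : riesz β p = ∫ z, evalAt z p ∂μ := by
  simp only [evalAt_eq_sum]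
  rw [integral_finsetSum _ fun k hk => (hμ.1 _ _ (add_le_of_mem_support hp hk)).const_mul _]
  conv_lhs => rw [p.as_sum]
  rw [map_sum]
  refine Finset.sum_congr rfl fun k hk => ?_
  rw [riesz_monomial, integral_const_mul, hμ.2 _ _ (add_le_of_mem_support hp hk)]

/-- A representing measure is supported in the zero set of every column relation. -/
theorem IsRepresenting.support_subset (hμ : IsRepresenting n β μ) {p : MvPolynomial (Fin 2) ℝ}
    (hp : p ∈ polysLE n) (h0 : column n β p = 0) : μ.support ⊆ zeroSet p := by
  have hpp : p * p ∈ polysLE (2 * n) := by rw [two_mul]; exact mul_mem_polysLE hp hp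
  have h1 := (column_eq_zero_iff hp).1 h0 p hp
  rw [hμ.riesz_eq hpp, integral_eq_zero_iff_of_nonneg
    (fun z => by simp only [map_mul]; exact mul_self_nonneg _) (hμ.1.integrable hpp)] at h1
  refine Measure.support_subset_of_isClosed
    (isClosed_eq (continuous_evalAt p) continuous_const) ?_
  filter_upwards [h1] with z hz
  rw [map_mul] at hz
  exact mul_self_eq_zero.1 hz

theorem IsRepresenting.support_subset_variety (hμ : IsRepresenting n β μ) :
    μ.support ⊆ variety n β := fun _ hz _ hp h0 =>
  hμ.support_subset (mem_polysLE.2 hp) h0 hz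

/-- The measure is carried by the variety, so polynomials vanishing there integrate to zero against
every test polynomial and are column relations. -/
theorem IsRepresenting.rank_le_encard_variety (hμ : IsRepresenting n β μ) :
    ((momentMatrix n β).rank : ℕ∞) ≤ (variety n β).encard := by
  by_cases hfin : (variety n β).Finite
  · rw [hfin.encard_eq_coe_toFinset_card, Nat.cast_le]
    refine rank_le_card fun p hp h0 => (column_eq_zero_iff hp).2 fun q hq => ?_
    rw [hμ.riesz_eq (by rw [two_mul]; exact mul_mem_polysLE hp hq)]
    refine integral_eq_zero_of_ae ?_
    filter_upwards [μ.support_mem_ae] with z hz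
    rw [map_mul, h0 z (by simpa using hμ.support_subset_variety hz), zero_mul, Pi.zero_apply]
  · rw [Set.Infinite.encard_eq hfin]
    exact le_top

end Measures

/-! ### Finitely atomic measures and their moment matrices -/

section Atoms

variable {n : ℕ} {β : ℕ → ℕ → ℝ} {S : Finset (ℝ × ℝ)} {c : ℝ × ℝ → ℝ}

/-- The measure with atoms `z ∈ S` of mass `c z`. -/
noncomputable def atomicMeasure (S : Finset (ℝ × ℝ)) (c : ℝ × ℝ → ℝ) : Measure (ℝ × ℝ) :=
  ∑ z ∈ S, ENNReal.ofReal (c z) • Measure.dirac z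

theorem integrable_atomicMeasure (S : Finset (ℝ × ℝ)) (c f : ℝ × ℝ → ℝ) :
    Integrable f (atomicMeasure S c) := by
  rw [atomicMeasure, integrable_finsetSum_measure]
  exact fun z _ => (integrable_dirac (by simp)).smul_measure ENNReal.ofReal_ne_top

theorem integral_atomicMeasure (hc : ∀ z ∈ S, 0 < c z) (f : ℝ × ℝ → ℝ) :
    ∫ z, f z ∂(atomicMeasure S c) = ∑ z ∈ S, c z * f z := by
  rw [atomicMeasure, integral_finsetSum_measure fun z _ =>
    (integrable_dirac (by simp)).smul_measure ENNReal.ofReal_ne_top]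
  refine Finset.sum_congr rfl fun z hz => ?_
  rw [integral_smul_measure, integral_dirac, ENNReal.toReal_ofReal (hc z hz).le, smul_eq_mul]

theorem support_atomicMeasure (hc : ∀ z ∈ S, 0 < c z) :
    (atomicMeasure S c).support = (S : Set (ℝ × ℝ)) := by
  apply Set.Subset.antisymm
  · refine Measure.support_subset_of_isClosed S.finite_toSet.isClosed ?_
    rw [mem_ae_iff, atomicMeasure, Measure.finsetSum_apply]
    refine Finset.sum_eq_zero fun z hz => ?_
    rw [Measure.smul_apply, Measure.dirac_apply' _ S.finite_toSet.measurableSet.compl]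
    simp [hz]
  · intro z hz
    rw [Measure.mem_support_iff_forall]
    intro U hU
    have h1 : (ENNReal.ofReal (c z) • Measure.dirac z) U ≤ atomicMeasure S c U := by
      rw [atomicMeasure, Measure.finsetSum_apply]
      exact Finset.single_le_sum (f := fun z => (ENNReal.ofReal (c z) • Measure.dirac z) U)
        (fun _ _ => zero_le) hz
    refine lt_of_lt_of_le ?_ h1
    rw [Measure.smul_apply, Measure.dirac_apply_of_mem (mem_of_mem_nhds hU), smul_eq_mul, mul_one]
    exact ENNReal.ofReal_pos.2 (hc z hz)

/-- The moments of the measure with atoms `z ∈ S` of mass `c z`. -/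
noncomputable def atomicMoments (S : Finset (ℝ × ℝ)) (c : ℝ × ℝ → ℝ) (i j : ℕ) : ℝ :=
  ∑ z ∈ S, c z * (z.2 ^ i * z.1 ^ j)

theorem riesz_atomicMoments (S : Finset (ℝ × ℝ)) (c : ℝ × ℝ → ℝ) (p : MvPolynomial (Fin 2) ℝ) :
    riesz (atomicMoments S c) p = ∑ z ∈ S, c z * evalAt z p := by
  simp only [evalAt_eq_sum, Finset.mul_sum]
  rw [Finset.sum_comm]
  conv_lhs => rw [p.as_sum]
  rw [map_sum]
  refine Finset.sum_congr rfl fun k _ => ?_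
  rw [riesz_monomial, atomicMoments, Finset.mul_sum]
  exact Finset.sum_congr rfl fun z _ => by ring

theorem posSemidef_atomicMoments (hc : ∀ z ∈ S, 0 < c z) (k : ℕ) :
    (momentMatrix k (atomicMoments S c)).PosSemidef := by
  refine posSemidef_iff.2 fun p _ => ?_
  rw [riesz_atomicMoments]
  refine Finset.sum_nonneg fun z hz => mul_nonneg (hc z hz).le ?_
  rw [map_mul]
  exact mul_self_nonneg _

/-- A positively weighted sum of squares vanishes only termwise. Recursive generation and the rank
bounds for atomic moments rest on this. -/
theorem column_atomicMoments_eq_zero_iff (hc : ∀ z ∈ S, 0 < c z) {k : ℕ}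
    {p : MvPolynomial (Fin 2) ℝ} (hp : p ∈ polysLE k) :
    column k (atomicMoments S c) p = 0 ↔ ∀ z ∈ S, evalAt z p = 0 := by
  rw [column_eq_zero_iff_sq (posSemidef_atomicMoments hc k) hp, riesz_atomicMoments,
    Finset.sum_eq_zero_iff_of_nonneg fun z hz => mul_nonneg (hc z hz).le (by
      rw [map_mul]; exact mul_self_nonneg _)]
  refine forall₂_congr fun z hz => ?_
  rw [map_mul, mul_eq_zero, or_iff_right (hc z hz).ne', mul_self_eq_zero]

theorem recursivelyGenerated_atomicMoments (hc : ∀ z ∈ S, 0 < c z) (k : ℕ) :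
    RecursivelyGenerated k (atomicMoments S c) := by
  intro p q hp _ hpq h0
  rw [column_atomicMoments_eq_zero_iff hc (mem_polysLE.2 hp)] at h0
  rw [column_atomicMoments_eq_zero_iff hc (mem_polysLE.2 hpq)]
  intro z hz
  rw [map_mul, h0 z hz, zero_mul]

theorem rank_atomicMoments_le (hc : ∀ z ∈ S, 0 < c z) (k : ℕ) :
    (momentMatrix k (atomicMoments S c)).rank ≤ S.card :=
  rank_le_card fun _ hp h => (column_atomicMoments_eq_zero_iff hc hp).2 h

theorem card_le_rank_atomicMoments (hc : ∀ z ∈ S, 0 < c z) {k : ℕ} {T : Finset (ℝ × ℝ)}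
    (hTS : T ⊆ S) (hT : Separates k T) : T.card ≤ (momentMatrix k (atomicMoments S c)).rank :=
  card_le_rank hT fun _ hp h z hz => (column_atomicMoments_eq_zero_iff hc hp).1 h z (hTS hz)

theorem extends_atomicMoments
    (hβ : ∀ p ∈ polysLE (2 * n), riesz β p = ∑ z ∈ S, c z * evalAt z p) :
    Extends n β (atomicMoments S c) := by
  intro i j hij
  have := hβ (monomial (expo (i, j)) 1) (monomial_mem_polysLE (by
    rw [expo_zero, expo_one]; omega))
  rw [riesz_monomial, expo_zero, expo_one, one_mul] at this
  rw [this, atomicMoments]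
  refine Finset.sum_congr rfl fun z _ => ?_
  rw [evalAt_monomial, expo_zero, expo_one, one_mul]

theorem momentMatrix_eq_of_extends {β' : ℕ → ℕ → ℝ} (h : Extends n β β') :
    momentMatrix n β' = momentMatrix n β := by
  ext a b
  have ha := mem_monomials.1 a.2
  have hb := mem_monomials.1 b.2
  exact h _ _ (by omega)

theorem isRepresenting_atomicMeasure (hc : ∀ z ∈ S, 0 < c z) (h : Extends n β (atomicMoments S c)) :
    IsRepresenting n β (atomicMeasure S c) :=
  ⟨fun _ _ _ => integrable_atomicMeasure _ _ _, fun i j hij => by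
    rw [← h i j hij, integral_atomicMeasure hc, atomicMoments]⟩

end Atoms

/-! ### Measures and extensions obtained from atoms -/

section HasAtoms

variable {n : ℕ} {β : ℕ → ℕ → ℝ}

/-- Separation in degree `n` makes the number of atoms equal to the rank. In the exceptional case
all atoms but one are separated, so `rank M(n) ≥ 2 * n + 1`, and the clause for rank at most `2 * n`
is vacuous. -/
theorem HasAtoms.exists_card (h : HasAtoms n β) :
    ∃ (S : Finset (ℝ × ℝ)) (c : ℝ × ℝ → ℝ), (∀ z ∈ S, 0 < c z) ∧
      Extends n β (atomicMoments S c) ∧ Separates (n + 1) S ∧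
      S.card ≤ 1 + (momentMatrix n β).rank ∧
      ((momentMatrix n β).rank ≤ 2 * n → S.card = (momentMatrix n β).rank) := by
  obtain ⟨S, c, hc, hβ, hsep, hS⟩ := h
  have hext := extends_atomicMoments hβ
  have hle := rank_atomicMoments_le hc n
  rw [momentMatrix_eq_of_extends hext] at hle
  refine ⟨S, c, hc, hext, hsep, ?_⟩
  rcases hS with hS | ⟨z, hz, hS, hcard⟩
  · have := card_le_rank_atomicMoments hc (Finset.Subset.refl S) hS
    rw [momentMatrix_eq_of_extends hext] at this
    omega
  · have := card_le_rank_atomicMoments hc (Finset.erase_subset z S) hS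
    rw [momentMatrix_eq_of_extends hext, Finset.card_erase_of_mem hz] at this
    omega

theorem HasAtoms.exists_measure (h : HasAtoms n β) (m : ℕ) :
    ∃ μ : Measure (ℝ × ℝ), IsRepresenting n β μ ∧ HasMoments m μ := by
  obtain ⟨S, c, hc, hext, -⟩ := h.exists_card
  exact ⟨_, isRepresenting_atomicMeasure hc hext, fun _ _ _ => integrable_atomicMeasure _ _ _⟩

theorem HasAtoms.exists_support (h : HasAtoms n β) :
    (∃ μ : Measure (ℝ × ℝ), IsRepresenting n β μ ∧
      μ.support.encard ≤ ((1 + (momentMatrix n β).rank : ℕ) : ℕ∞)) ∧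
    ((momentMatrix n β).rank ≤ 2 * n → ∃ μ : Measure (ℝ × ℝ), IsRepresenting n β μ ∧
      μ.support.encard = ((momentMatrix n β).rank : ℕ∞)) := by
  obtain ⟨S, c, hc, hext, -, h1, h2⟩ := h.exists_card
  have hr := isRepresenting_atomicMeasure hc hext
  refine ⟨⟨_, hr, ?_⟩, fun hle => ⟨_, hr, ?_⟩⟩
  · rw [support_atomicMeasure hc, Set.encard_coe_eq_coe_finsetCard]
    exact Nat.cast_le.2 h1
  · rw [support_atomicMeasure hc, Set.encard_coe_eq_coe_finsetCard, h2 hle]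

/-- The same atomic moments serve as both extensions: separation in degree `n + 1` makes `M(n + 1)`
and `M(n + 2)` have rank equal to the number of atoms. -/
theorem HasAtoms.exists_flatExtends (h : HasAtoms n β) :
    (∃ β' : ℕ → ℕ → ℝ, PosRecExtends n β β' ∧
      (momentMatrix (n + 1) β').rank ≤ 1 + (momentMatrix n β).rank ∧
      ∃ β'' : ℕ → ℕ → ℝ, FlatExtends (n + 1) β' β'') ∧
    ((momentMatrix n β).rank ≤ 2 * n → ∃ β' : ℕ → ℕ → ℝ, FlatExtends n β β') := by
  obtain ⟨S, c, hc, hext, hsep, h1, h2⟩ := h.exists_card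
  have hle := rank_atomicMoments_le hc
  have hge1 := card_le_rank_atomicMoments hc (Finset.Subset.refl S) hsep
  have hge2 := card_le_rank_atomicMoments hc (Finset.Subset.refl S)
    (hsep.mono_degree (Nat.le_succ _))
  refine ⟨⟨_, ⟨hext, posSemidef_atomicMoments hc _, recursivelyGenerated_atomicMoments hc _⟩,
    (hle _).trans h1, _, fun _ _ _ => rfl, ?_⟩, fun hr => ⟨_, hext, ?_⟩⟩
  · exact ((hle _).antisymm hge2).trans ((hle _).antisymm hge1).symm
  · rw [← h2 hr]
    exact (hle _).antisymm hge1

end HasAtoms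

end TruncMoment

/-! ### Uniting the two cases and the cycle of implications -/

namespace TruncMoment

open MvPolynomial

section Hyperbola

variable {u v Q : MvPolynomial (Fin 2) ℝ} {κ : ℝ} {n : ℕ} {β : ℕ → ℕ → ℝ}
  {l : MvPolynomial (Fin 2) ℝ →ₗ[ℝ] ℝ}

/-- The inverse of `u` on the curve `u * v = κ`. -/
theorem AffineCoords.exists_inverse (A : AffineCoords u v) (hQ : Q = u * v - C κ) (hκ : κ ≠ 0) :
    ∃ w ∈ polysLE 1, v = C κ * w ∧ Q ∣ w * u - 1 := by
  have h1 : (C κ * C κ⁻¹ : MvPolynomial (Fin 2) ℝ) = 1 := by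
    rw [← C_mul, mul_inv_cancel₀ hκ, C_1]
  refine ⟨C κ⁻¹ * v, ?_, ?_, C κ⁻¹, ?_⟩
  · rw [← smul_eq_C_mul]
    exact Submodule.smul_mem _ _ A.v_mem
  · rw [← mul_assoc, h1, one_mul]
  · rw [hQ]
    linear_combination h1

theorem rank_le_of_isRieszMod (A : AffineCoords u v) (hQ : Q = u * v - C κ)
    (hpos : (momentMatrix n β).PosSemidef) (hl : IsRieszMod Q n β l) :
    (momentMatrix n β).rank ≤ 2 * n + 1 := by
  by_cases hκ : κ = 0
  · subst hκ
    exact rank_le_of_degenerate A hQ hpos hl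
  · obtain ⟨w, _, hv, hw⟩ := A.exists_inverse hQ hκ
    exact rank_le_of_nondegenerate A hQ hκ hv hw hpos hl

theorem hasAtoms_of_stronglyRecursive (A : AffineCoords u v) (hQ : Q = u * v - C κ) (hn : 1 ≤ n)
    (hpos : (momentMatrix n β).PosSemidef) (hl : IsRieszMod Q n β l)
    (hrec : StronglyRecursive u v Q n l) : HasAtoms n β := by
  by_cases hκ : κ = 0
  · subst hκ
    exact hasAtoms_of_degenerate A hQ hn hpos hl hrec
  · obtain ⟨w, hw1, hv, hw⟩ := A.exists_inverse hQ hκ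
    exact hasAtoms_of_nondegenerate A hQ hκ hv hw1 hw hpos hl hrec

theorem stronglyRecursive_of_rank_le (A : AffineCoords u v) (hQ : Q = u * v - C κ) (hn : 2 ≤ n)
    (hpos : (momentMatrix n β).PosSemidef) (hrec : RecursivelyGenerated n β)
    (hl : IsRieszMod Q n β l) (hVQ : ∀ z ∈ variety n β, evalAt z Q = 0)
    (hr : ((momentMatrix n β).rank : ℕ∞) ≤ (variety n β).encard) :
    StronglyRecursive u v Q n l := by
  by_cases hκ : κ = 0
  · subst hκ
    exact stronglyRecursive_of_degenerate A hQ hn hpos hrec hl hVQ hr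
  · obtain ⟨w, hw1, hv, hw⟩ := A.exists_inverse hQ hκ
    exact stronglyRecursive_of_nondegenerate A hQ hκ hv hw1 hw hpos hl hVQ hr

end Hyperbola

end TruncMoment

theorem theorem1p4 (Q : MvPolynomial (Fin 2) ℝ) (hQ : IsHyperbola Q)
    (n : ℕ) (hn : 2 ≤ n) (β : ℕ → ℕ → ℝ) (hβ : 0 < β 0 0)
    (hpos : (momentMatrix n β).PosSemidef)
    (hrec : RecursivelyGenerated n β)
    (hcol : column n β Q = 0) :
    (momentMatrix n β).rank ≤ 2 * n + 1 ∧
    (∀ μ : MeasureTheory.Measure (ℝ × ℝ), IsRepresenting n β μ → μ.support ⊆ zeroSet Q) ∧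
    List.TFAE [
      ∃ μ : MeasureTheory.Measure (ℝ × ℝ), IsRepresenting n β μ,
      ∃ μ : MeasureTheory.Measure (ℝ × ℝ), IsRepresenting n β μ ∧ HasMoments (2 * n + 2) μ,
      (∃ μ : MeasureTheory.Measure (ℝ × ℝ), IsRepresenting n β μ ∧
        μ.support.encard ≤ ((1 + (momentMatrix n β).rank : ℕ) : ℕ∞)) ∧
      ((momentMatrix n β).rank ≤ 2 * n →
        ∃ μ : MeasureTheory.Measure (ℝ × ℝ), IsRepresenting n β μ ∧
          μ.support.encard = ((momentMatrix n β).rank : ℕ∞)),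
      ∃ β' : ℕ → ℕ → ℝ, PosRecExtends n β β',
      (∃ β' : ℕ → ℕ → ℝ, PosRecExtends n β β' ∧
        (momentMatrix (n + 1) β').rank ≤ 1 + (momentMatrix n β).rank ∧
        ∃ β'' : ℕ → ℕ → ℝ, FlatExtends (n + 1) β' β'') ∧
      ((momentMatrix n β).rank ≤ 2 * n → ∃ β' : ℕ → ℕ → ℝ, FlatExtends n β β'),
      ((momentMatrix n β).rank : ℕ∞) ≤ (variety n β).encard] := by
  obtain ⟨u, v, κ, ⟨A⟩, hQuv⟩ := hQ.exists_coords
  have hQ2 := A.totalDegree_eq hQuv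
  have hQn : Q ∈ polysLE n := mem_polysLE.2 (by omega)
  have hVQ : ∀ z ∈ variety n β, evalAt z Q = 0 := fun z hz => mem_variety_iff.1 hz Q hQn hcol
  obtain ⟨l, hl1, hl2⟩ := exists_riesz_mod hQ2 hn hrec hcol
  have hl : IsRieszMod Q n β l := ⟨hl1, hl2⟩
  refine ⟨rank_le_of_isRieszMod A hQuv hpos hl, fun μ hμ => hμ.support_subset hQn hcol, ?_⟩
  have hatoms := hasAtoms_of_stronglyRecursive A hQuv (one_le_two.trans hn) hpos hl
  -- Strong recursiveness, and with it the atoms, is reached from the variety condition and from the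
  -- extension condition; the remaining implications are direct.
  tfae_have 1 → 6 := fun ⟨_, hμ⟩ => hμ.rank_le_encard_variety
  tfae_have 6 → 5 := fun h =>
    (hatoms (stronglyRecursive_of_rank_le A hQuv hn hpos hrec hl hVQ h)).exists_flatExtends
  tfae_have 5 → 4 := fun ⟨⟨β', h, _⟩, _⟩ => ⟨β', h⟩
  tfae_have 4 → 2 := fun ⟨_, h⟩ =>
    (hatoms (stronglyRecursive_of_extension A hQ2 hn hpos hcol hl h)).exists_measure _
  tfae_have 4 → 3 := fun ⟨_, h⟩ =>
    (hatoms (stronglyRecursive_of_extension A hQ2 hn hpos hcol hl h)).exists_support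
  tfae_have 2 → 1 := fun ⟨μ, hμ, _⟩ => ⟨μ, hμ⟩
  tfae_have 3 → 1 := fun ⟨⟨μ, hμ, _⟩, _⟩ => ⟨μ, hμ⟩
  tfae_finish
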